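/- Let $n\ge 1$, let $\mathcal M_x=S^2_+T_x^*M$ be the set of positive definite symmetric $(0,2)$-tensors on the tangent space $T_xM$ of an $n$-dimensional manifold $M$ at a point $x$, an open subset of the vector space $\mathcal S_x=S^2T_x^*M$ of all symmetric $(0,2)$-tensors, and let $g\in\mathcal M_x$ be a fixed reference inner product. (With respect to a basis of $T_xM$, these are the positive definite and the symmetric real $n\times n$ matrices.) For $a\in\mathcal M_x$ put $A=g^{-1}a$, and for $b,c\in\mathcal S_x$ put $\operatorname{tr}_a(b)=\operatorname{tr}(a^{-1}b)$, $\operatorname{tr}_a(bc)=\operatorname{tr}(a^{-1}b\,a^{-1}c)$ and $b_T=b-\frac1n\operatorname{tr}_a(b)\,a$. Equip $\mathcal M_x$ with the Riemannian metric $\langle b,c\rangle_a=\operatorname{tr}_a(bc)\sqrt{\det A}$, let $d_x$ be its distance function, and let $\overline{\mathcal M_x}$ be the metric completion of $(\mathcal M_x,d_x)$, with metric again denoted by $d_x$. Let $[0]\in\overline{\mathcal M_x}$ be the point represented by the zero tensor, i.e. the limit of $s g$ as $s\to0^+$. A minimal path is a continuous path $\gamma:[0,1]\to\overline{\mathcal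 M_x}$ whose length between any two of its points equals their distance. 1. For all $p,q\in\overline{\mathcal M_x}$ there is exactly one minimal path $\gamma:[0,1]\to\overline{\mathcal M_x}$ from $p$ to $q$ that is parametrized proportionally to arc length. 2. These paths depend continuously on their endpoints: let $p_k\to p$ and $q_k\to q$ in $(\overline{\mathcal M_x},d_x)$, and let $\gamma_k$ and $\gamma$ be the minimal paths, parametrized proportionally to arc length, from $p_k$ to $q_k$ and from $p$ to $q$. Then $\gamma_k\to\gamma$ in $C^0([0,1],\overline{\mathcal M_x})$, i.e. uniformly with respect to $d_x$. 3. Let $a_0,a_1\in\mathcal M_x$ and $b\in\mathcal S_x$ with $a_1=a_0\exp(a_0^{-1}b)$, let $b_T$ be taken with respect to $a_0$, and let $\gamma$ be the minimal path from $a_0$ to $a_1$, parametrized proportionally to arc length. If $\operatorname{tr}_{a_0}(b_T^2)<(4\pi)^2/n$, then $\gamma$ stays in $\mathcal M_x$ (so that it is a Riemannian geodesic). If $\operatorname{tr}_{a_0}(b_T^2)\ge(4\pi)^2/n$, then $\gamma$ is the concatenation of the straight segments from $a_0$ to $[0]$ and from $[0]$ to $a_1$: with $\tau=\frac{(\det A_0)^{1/4}}{(\det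 A_0)^{1/4}+(\det A_1)^{1/4}}$ one has $\gamma(t)=(1-t/\tau)^{4/n}a_0$ for $0\le t<\tau$, $\gamma(\tau)=[0]$, and $\gamma(t)=\left(\frac{t-\tau}{1-\tau}\right)^{4/n}a_1$ for $\tau<t\le1$. In particular, the continuity in 2 includes the borderline case $\operatorname{tr}_{a_0}(b_T^2)=(4\pi)^2/n$: Riemannian geodesics from $a_0$ to points $a_k\to a_1$ whose parameters are below the threshold converge uniformly to the path through $[0]$ described in 3. -/

import Mathlib

open Filter Topology

namespace MetricFiber

/-- `tr_a(bc) = tr(a⁻¹ b a⁻¹ c)`, the scalar product which the inner product `a` induces on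
`(0,2)`-tensors (written in components with respect to a basis). -/
noncomputable def trProd {n : ℕ} (a b c : Matrix (Fin n) (Fin n) ℝ) : ℝ :=
  (a⁻¹ * b * (a⁻¹ * c)).trace

/-- `det A`, where `A = g⁻¹ a` is the endomorphism obtained from `a` by raising an index with
the reference inner product `g`. -/
noncomputable def relDet {n : ℕ} (g a : Matrix (Fin n) (Fin n) ℝ) : ℝ := (g⁻¹ * a).det

/-- The fourth root of `det A`. -/
noncomputable def fourthRootDet {n : ℕ} (g a : Matrix (Fin n) (Fin n) ℝ) : ℝ :=
  relDet g a ^ (1 / 4 : ℝ)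

/-- The Riemannian metric `⟨b, c⟩_a = tr_a(bc) √(det A)`. -/
noncomputable def riemInner {n : ℕ} (g a b c : Matrix (Fin n) (Fin n) ℝ) : ℝ :=
  trProd a b c * √(relDet g a)

/-- The norm `|b|_a` of the tangent vector `b` at `a`. -/
noncomputable def riemNorm {n : ℕ} (g a b : Matrix (Fin n) (Fin n) ℝ) : ℝ :=
  √(riemInner g a b b)

/-- The `a`-traceless part `b_T = b - (1/n) (tr_a b) a` of `b`. -/
noncomputable def traceless {n : ℕ} (a b : Matrix (Fin n) (Fin n) ℝ) :
    Matrix (Fin n) (Fin n) ℝ :=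
  b - ((1 / (n : ℝ)) * (a⁻¹ * b).trace) • a

/-- The fiber `S²₊ T*_x M`: positive definite symmetric `(0,2)`-tensors on an `n`-dimensional
space, in components with respect to a basis. It carries the reference inner product `g` as a
parameter because its Riemannian metric depends on `g`. -/
def Fiber {n : ℕ} (_g : Matrix (Fin n) (Fin n) ℝ) : Type :=
  {a : Matrix (Fin n) (Fin n) ℝ // a.PosDef}

/-- The matrix of components of a point of the fiber. -/
def Fiber.mat {n : ℕ} {g : Matrix (Fin n) (Fin n) ℝ} (a : Fiber g) :
    Matrix (Fin n) (Fin n) ℝ := a.1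

/-- A positive definite matrix as a point of the fiber. -/
def Fiber.ofPosDef {n : ℕ} {g a : Matrix (Fin n) (Fin n) ℝ} (ha : a.PosDef) : Fiber g := ⟨a, ha⟩

theorem Fiber.posDef {n : ℕ} {g : Matrix (Fin n) (Fin n) ℝ} (a : Fiber g) : a.mat.PosDef := a.2

/-- The componentwise velocity of a curve of matrices on `[0,1]` (one-sided at the ends). -/
noncomputable def velocity {n : ℕ} (c : ℝ → Matrix (Fin n) (Fin n) ℝ) (t : ℝ) :
    Matrix (Fin n) (Fin n) ℝ :=
  Matrix.of fun i j => derivWithin (fun s => c s i j) (Set.Icc 0 1) t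

/-- A `C¹` arc `[0,1] → S²₊ T*_x M` from `p` to `q`. -/
structure C1Arc {n : ℕ} {g : Matrix (Fin n) (Fin n) ℝ} (p q : Fiber g) where
  toFun : ℝ → Matrix (Fin n) (Fin n) ℝ
  contDiffOn : ∀ i j, ContDiffOn ℝ 1 (fun t => toFun t i j) (Set.Icc 0 1)
  posDef : ∀ t ∈ Set.Icc (0 : ℝ) 1, (toFun t).PosDef
  source : toFun 0 = p.mat
  target : toFun 1 = q.mat

/-- The Riemannian length of a `C¹` arc. -/
noncomputable def C1Arc.length {n : ℕ} {g : Matrix (Fin n) (Fin n) ℝ} {p q : Fiber g}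
    (c : C1Arc p q) : ℝ :=
  ∫ t in (0 : ℝ)..1, riemNorm g (c.toFun t) (velocity c.toFun t)

/-- A piecewise `C¹` path from `p` to `q`: a finite concatenation of `C¹` arcs. -/
inductive PiecewiseC1Path {n : ℕ} {g : Matrix (Fin n) (Fin n) ℝ} :
    Fiber g → Fiber g → Type
  | nil (p : Fiber g) : PiecewiseC1Path p p
  | cons {p q r : Fiber g} (c : C1Arc p q) (σ : PiecewiseC1Path q r) : PiecewiseC1Path p r

/-- The Riemannian length of a piecewise `C¹` path. -/
noncomputable def PiecewiseC1Path.length {n : ℕ} {g : Matrix (Fin n) (Fin n) ℝ} :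
    {p q : Fiber g} → PiecewiseC1Path p q → ℝ
  | _, _, .nil _ => 0
  | _, _, .cons c σ => c.length + σ.length

/-- The distance `d_x` of the Riemannian metric `⟨·,·⟩`: the infimum of the lengths of the
piecewise `C¹` paths between two points. -/
noncomputable def riemDist {n : ℕ} {g : Matrix (Fin n) (Fin n) ℝ} (p q : Fiber g) : ℝ :=
  ⨅ σ : PiecewiseC1Path p q, σ.length

section PseudoMetric

variable {n : ℕ} {g : Matrix (Fin n) (Fin n) ℝ}

theorem C1Arc.length_nonneg {p q : Fiber g} (c : C1Arc p q) : 0 ≤ c.length :=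
  intervalIntegral.integral_nonneg zero_le_one fun _ _ => Real.sqrt_nonneg _

theorem PiecewiseC1Path.length_nonneg {p q : Fiber g} (σ : PiecewiseC1Path p q) :
    0 ≤ σ.length := by
  induction σ with
  | nil p => exact le_refl _
  | cons c σ ih => exact add_nonneg c.length_nonneg ih

theorem PiecewiseC1Path.bddBelow (p q : Fiber g) :
    BddBelow (Set.range fun σ : PiecewiseC1Path p q => σ.length) :=
  ⟨0, by rintro _ ⟨σ, rfl⟩; exact σ.length_nonneg⟩

theorem riemDist_le {p q : Fiber g} (σ : PiecewiseC1Path p q) : riemDist p q ≤ σ.length :=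
  ciInf_le (PiecewiseC1Path.bddBelow p q) σ

theorem riemNorm_neg (a b : Matrix (Fin n) (Fin n) ℝ) : riemNorm g a (-b) = riemNorm g a b := by
  simp [riemNorm, riemInner, trProd]

/-- The straight segment between two points. -/
noncomputable def C1Arc.segment (p q : Fiber g) : C1Arc p q where
  toFun t := (1 - t) • p.mat + t • q.mat
  contDiffOn i j := by
    simp only [Matrix.add_apply, Matrix.smul_apply, smul_eq_mul]
    exact ContDiff.contDiffOn (by fun_prop)
  posDef t ht := by
    rcases eq_or_lt_of_le ht.1 with h | h
    · rw [← h]; simpa using p.posDef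
    · exact Matrix.PosDef.posSemidef_add
        (p.posDef.posSemidef.smul (by linarith [ht.2])) (q.posDef.smul h)
  source := by simp
  target := by simp

instance (p q : Fiber g) : Nonempty (PiecewiseC1Path p q) :=
  ⟨.cons (C1Arc.segment p q) (.nil q)⟩

theorem mem_Icc_one_sub {t : ℝ} (ht : t ∈ Set.Icc (0 : ℝ) 1) : 1 - t ∈ Set.Icc (0 : ℝ) 1 :=
  ⟨by linarith [ht.2], by linarith [ht.1]⟩

/-- The reversed arc. -/
noncomputable def C1Arc.reverse {p q : Fiber g} (c : C1Arc p q) : C1Arc q p where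
  toFun t := c.toFun (1 - t)
  contDiffOn i j := by
    have h : ContDiffOn ℝ 1 (fun t : ℝ => 1 - t) (Set.Icc 0 1) :=
      ContDiff.contDiffOn (by fun_prop)
    exact (c.contDiffOn i j).comp h fun t ht => mem_Icc_one_sub ht
  posDef t ht := c.posDef _ (mem_Icc_one_sub ht)
  source := by simpa using c.target
  target := by simpa using c.source

theorem C1Arc.velocity_reverse {p q : Fiber g} (c : C1Arc p q) {t : ℝ}
    (ht : t ∈ Set.Icc (0 : ℝ) 1) :
    velocity c.reverse.toFun t = -velocity c.toFun (1 - t) := by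
  ext i j
  have h1 : HasDerivWithinAt (fun s => c.toFun s i j) (velocity c.toFun (1 - t) i j)
      (Set.Icc 0 1) (1 - t) :=
    (((c.contDiffOn i j).differentiableOn one_ne_zero) _ (mem_Icc_one_sub ht)).hasDerivWithinAt
  have h2 : HasDerivWithinAt (fun s : ℝ => 1 - s) (-1) (Set.Icc 0 1) t := by
    simpa using (hasDerivWithinAt_id t (Set.Icc (0 : ℝ) 1)).const_sub 1
  have h3 := h1.scomp t h2 fun s hs => mem_Icc_one_sub hs
  have h4 := h3.derivWithin (uniqueDiffOn_Icc zero_lt_one t ht)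
  simpa [velocity, C1Arc.reverse, Function.comp_def] using h4

theorem C1Arc.length_reverse {p q : Fiber g} (c : C1Arc p q) : c.reverse.length = c.length := by
  have h : c.reverse.length =
      ∫ t in (0 : ℝ)..1, riemNorm g (c.toFun (1 - t)) (velocity c.toFun (1 - t)) := by
    refine intervalIntegral.integral_congr fun t ht => ?_
    rw [Set.uIcc_of_le zero_le_one] at ht
    simp only [c.velocity_reverse ht, riemNorm_neg]
    rfl
  rw [h, intervalIntegral.integral_comp_sub_left
    (fun t => riemNorm g (c.toFun t) (velocity c.toFun t)) 1]
  simp [C1Arc.length]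

theorem PiecewiseC1Path.exists_append {p q r : Fiber g} (σ : PiecewiseC1Path p q)
    (τ : PiecewiseC1Path q r) :
    ∃ ρ : PiecewiseC1Path p r, ρ.length = σ.length + τ.length := by
  induction σ with
  | nil p => exact ⟨τ, by simp [PiecewiseC1Path.length]⟩
  | cons c σ ih =>
    obtain ⟨ρ, hρ⟩ := ih τ
    exact ⟨.cons c ρ, by simp [PiecewiseC1Path.length, hρ, add_assoc]⟩

theorem PiecewiseC1Path.exists_reverse {p q : Fiber g} (σ : PiecewiseC1Path p q) :
    ∃ ρ : PiecewiseC1Path q p, ρ.length = σ.length := by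
  induction σ with
  | nil p => exact ⟨.nil p, rfl⟩
  | cons c σ ih =>
    obtain ⟨ρ, hρ⟩ := ih
    obtain ⟨ρ', hρ'⟩ := ρ.exists_append (.cons c.reverse (.nil _))
    exact ⟨ρ', by simp [hρ', PiecewiseC1Path.length, hρ, c.length_reverse, add_comm]⟩

theorem riemDist_self (p : Fiber g) : riemDist p p = 0 :=
  le_antisymm (riemDist_le (.nil p)) (Real.iInf_nonneg fun σ => σ.length_nonneg)

theorem riemDist_comm_le (p q : Fiber g) : riemDist p q ≤ riemDist q p :=
  le_ciInf fun σ => by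
    obtain ⟨ρ, hρ⟩ := σ.exists_reverse
    exact hρ ▸ riemDist_le ρ

theorem riemDist_triangle (p q r : Fiber g) :
    riemDist p r ≤ riemDist p q + riemDist q r := by
  refine le_ciInf_add_ciInf fun σ τ => ?_
  obtain ⟨ρ, hρ⟩ := σ.exists_append τ
  exact hρ ▸ riemDist_le ρ

/-- The fiber as a (pseudo)metric space under `d_x`. -/
noncomputable instance : PseudoMetricSpace (Fiber g) where
  dist := riemDist
  dist_self := riemDist_self
  dist_comm p q := le_antisymm (riemDist_comm_le p q) (riemDist_comm_le q p)
  dist_triangle := riemDist_triangle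

end PseudoMetric

/-- The metric completion of `(S²₊ T*_x M, d_x)`. -/
abbrev CompletedFiber {n : ℕ} (g : Matrix (Fin n) (Fin n) ℝ) : Type :=
  UniformSpace.Completion (Fiber g)

/-- The tensor `s a`, for `s > 0`. -/
noncomputable def Fiber.scale {n : ℕ} {g : Matrix (Fin n) (Fin n) ℝ} (a : Fiber g) (s : ℝ)
    (hs : 0 < s) : Fiber g :=
  ⟨s • a.mat, a.posDef.smul hs⟩

/-- The singular point `[0]` of the completion, represented by the zero tensor: the limit of
the tensors `s g` as `s → 0`, `s > 0`. -/
noncomputable def zeroPoint {n : ℕ} {g : Matrix (Fin n) (Fin n) ℝ} (hg : g.PosDef) :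
    CompletedFiber g :=
  haveI : Nonempty (CompletedFiber g) := ⟨((Fiber.ofPosDef hg : Fiber g) : CompletedFiber g)⟩
  limUnder (atTop : Filter ℕ) fun k =>
    (((Fiber.ofPosDef hg : Fiber g).scale (1 / ((k : ℝ) + 1)) Nat.one_div_pos_of_nat :
      Fiber g) : CompletedFiber g)

section ZeroPoint

variable {n : ℕ} {g : Matrix (Fin n) (Fin n) ℝ}

/-- The arc `λ a`, where `λ^(n/4)` runs linearly from `s` to `t`. -/
noncomputable def C1Arc.radial (a : Fiber g) (s t : ℝ) (hs : 0 < s) (ht : 0 < t) :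
    C1Arc (a.scale (s ^ (4 / (n : ℝ))) (Real.rpow_pos_of_pos hs _))
      (a.scale (t ^ (4 / (n : ℝ))) (Real.rpow_pos_of_pos ht _)) where
  toFun u := (((1 - u) * s + u * t) ^ (4 / (n : ℝ))) • a.mat
  contDiffOn i j := by
    simp only [Matrix.smul_apply, smul_eq_mul]
    refine ContDiffOn.mul (ContDiffOn.rpow_const_of_ne (ContDiff.contDiffOn (by fun_prop)) ?_)
      contDiffOn_const
    intro u hu
    exact (convex_Ioi (0 : ℝ) hs ht (by linarith [hu.2]) hu.1 (by ring)).ne'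
  posDef u hu := a.posDef.smul
    (Real.rpow_pos_of_pos (convex_Ioi (0 : ℝ) hs ht (by linarith [hu.2]) hu.1 (by ring)) _)
  source := by simp [Fiber.scale, Fiber.mat]
  target := by simp [Fiber.scale, Fiber.mat]

theorem riemNorm_radial (hn : 1 ≤ n) (a : Fiber g) {l v : ℝ} (hl : 0 < l) :
    riemNorm g ((l ^ (4 / (n : ℝ))) • a.mat) ((v * (4 / (n : ℝ)) * l ^ (4 / (n : ℝ) - 1)) • a.mat)
      = |v| * √(16 / n * √(relDet g a.mat)) := by
  have hn' : (0 : ℝ) < n := by exact_mod_cast hn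
  have hu : IsUnit a.mat.det := a.posDef.det_pos.ne'.isUnit
  set m := l ^ (4 / (n : ℝ)) with hm
  have hm0 : 0 < m := Real.rpow_pos_of_pos hl _
  have h1 : l ^ (4 / (n : ℝ) - 1) = m / l := by rw [Real.rpow_sub_one hl.ne']
  have h2 : relDet g (m • a.mat) = (l ^ 2) ^ 2 * relDet g a.mat := by
    have : m ^ n = (l ^ 2) ^ 2 := by
      rw [hm, ← Real.rpow_natCast, ← Real.rpow_mul hl.le, div_mul_cancel₀ _ hn'.ne', ← pow_mul]
      exact_mod_cast Real.rpow_natCast l 4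
    simp [relDet, this]
  have hinv : (m • a.mat)⁻¹ = m⁻¹ • a.mat⁻¹ := by
    refine Matrix.inv_eq_left_inv ?_
    rw [Matrix.smul_mul, Matrix.mul_smul, smul_smul, inv_mul_cancel₀ hm0.ne', one_smul,
      Matrix.nonsing_inv_mul _ hu]
  have h3 : trProd (m • a.mat) ((v * (4 / (n : ℝ)) * (m / l)) • a.mat)
      ((v * (4 / (n : ℝ)) * (m / l)) • a.mat) = (v / l) ^ 2 * (16 / n) := by
    simp only [trProd, hinv, Matrix.smul_mul, Matrix.mul_smul, smul_smul,
      Matrix.nonsing_inv_mul _ hu, Matrix.trace_smul, Matrix.trace_one, Matrix.one_mul,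
      Fintype.card_fin, smul_eq_mul]
    field_simp
    norm_num
  have h4 : √((l ^ 2) ^ 2 * relDet g a.mat) = l ^ 2 * √(relDet g a.mat) := by
    rw [Real.sqrt_mul (by positivity), Real.sqrt_sq (by positivity)]
  rw [riemNorm, riemInner, h1, h3, h2, h4]
  have : (v / l) ^ 2 * (16 / (n : ℝ)) * (l ^ 2 * √(relDet g a.mat))
      = v ^ 2 * (16 / n * √(relDet g a.mat)) := by
    field_simp
  rw [this, Real.sqrt_mul (sq_nonneg v), Real.sqrt_sq_eq_abs]

theorem C1Arc.length_radial (hn : 1 ≤ n) (a : Fiber g) (s t : ℝ) (hs : 0 < s) (ht : 0 < t) :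
    (C1Arc.radial a s t hs ht).length = |t - s| * √(16 / n * √(relDet g a.mat)) := by
  have key : ∀ u ∈ Set.uIcc (0 : ℝ) 1,
      riemNorm g ((C1Arc.radial a s t hs ht).toFun u)
        (velocity (C1Arc.radial a s t hs ht).toFun u)
        = |t - s| * √(16 / n * √(relDet g a.mat)) := by
    intro u hu
    rw [Set.uIcc_of_le zero_le_one] at hu
    have hl : 0 < (1 - u) * s + u * t :=
      convex_Ioi (0 : ℝ) hs ht (by linarith [hu.2]) hu.1 (by ring)
    have hv : velocity (C1Arc.radial a s t hs ht).toFun u =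
        ((t - s) * (4 / (n : ℝ)) * ((1 - u) * s + u * t) ^ (4 / (n : ℝ) - 1)) • a.mat := by
      ext i j
      have h1 : HasDerivAt (fun u : ℝ => (1 - u) * s + u * t) (t - s) u := by
        have := (((hasDerivAt_id u).const_sub 1).mul_const s).add ((hasDerivAt_id u).mul_const t)
        exact this.congr_deriv (by ring)
      have h2 := (h1.rpow_const (p := 4 / (n : ℝ)) (Or.inl hl.ne')).mul_const (a.mat i j)
      have h3 := h2.hasDerivWithinAt.derivWithin (uniqueDiffOn_Icc zero_lt_one u hu)
      simpa [velocity, C1Arc.radial] using h3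
    rw [hv]
    exact riemNorm_radial hn a hl
  rw [C1Arc.length, intervalIntegral.integral_congr key]
  simp

theorem dist_scale_le (hn : 1 ≤ n) (a : Fiber g) (s t : ℝ) (hs : 0 < s) (ht : 0 < t) :
    dist (a.scale s hs) (a.scale t ht) ≤
      |t ^ ((n : ℝ) / 4) - s ^ ((n : ℝ) / 4)| * √(16 / n * √(relDet g a.mat)) := by
  have hn' : (0 : ℝ) < n := by exact_mod_cast hn
  have key : ∀ (x : ℝ) (hx : 0 < x), a.scale ((x ^ ((n : ℝ) / 4)) ^ (4 / (n : ℝ)))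
      (Real.rpow_pos_of_pos (Real.rpow_pos_of_pos hx _) _) = a.scale x hx := by
    intro x hx
    have : (x ^ ((n : ℝ) / 4)) ^ (4 / (n : ℝ)) = x := by
      rw [← Real.rpow_mul hx.le]
      have : (n : ℝ) / 4 * (4 / n) = 1 := by field_simp
      rw [this, Real.rpow_one]
    simp only [this]
  have := riemDist_le (.cons (C1Arc.radial a _ _ (Real.rpow_pos_of_pos hs ((n : ℝ) / 4))
    (Real.rpow_pos_of_pos ht ((n : ℝ) / 4))) (.nil _))
  simp only [PiecewiseC1Path.length, C1Arc.length_radial hn, add_zero] at this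
  rwa [key, key] at this

/-- The limit which defines `zeroPoint` exists. -/
theorem tendsto_zeroPoint (hn : 1 ≤ n) (hg : g.PosDef) :
    Tendsto (fun k : ℕ => (((Fiber.ofPosDef hg : Fiber g).scale (1 / ((k : ℝ) + 1))
      Nat.one_div_pos_of_nat : Fiber g) : CompletedFiber g)) atTop (𝓝 (zeroPoint hg)) := by
  have hn' : (0 : ℝ) < n := by exact_mod_cast hn
  have h0 : Tendsto (fun k : ℕ => (1 / ((k : ℝ) + 1)) ^ ((n : ℝ) / 4)) atTop (𝓝 0) := by
    have := tendsto_one_div_add_atTop_nhds_zero_nat (𝕜 := ℝ)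
    have h := this.rpow_const (p := (n : ℝ) / 4) (Or.inr (by positivity))
    rwa [Real.zero_rpow (by positivity)] at h
  have hc : CauchySeq (fun k : ℕ => (Fiber.ofPosDef hg : Fiber g).scale (1 / ((k : ℝ) + 1))
      Nat.one_div_pos_of_nat) := by
    set C := √(16 / n * √(relDet g (Fiber.ofPosDef hg : Fiber g).mat)) with hC
    have h1 := (h0.mul_const C).cauchySeq
    rw [Metric.cauchySeq_iff] at h1 ⊢
    intro ε hε
    obtain ⟨N, hN⟩ := h1 ε hε
    refine ⟨N, fun k hk l hl => (dist_scale_le hn _ _ _ _ _).trans_lt ?_⟩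
    have := hN l hl k hk
    rwa [Real.dist_eq, ← sub_mul, abs_mul, abs_of_nonneg (Real.sqrt_nonneg _)] at this
  exact CauchySeq.tendsto_limUnder (α := CompletedFiber g)
    (hc.map (UniformSpace.Completion.uniformContinuous_coe (Fiber g)))

end ZeroPoint

/-- The straight segment from `[0]` (at `s = 0`) to `a` (at `s = 1`), that is, the tensors
`λ a` with `0 ≤ λ ≤ 1`; with `λ = s^(4/n)` the parameter `s` is proportional to arc length. -/
noncomputable def straight {n : ℕ} {g : Matrix (Fin n) (Fin n) ℝ} (hg : g.PosDef)
    (a : Fiber g) (s : ℝ) : CompletedFiber g :=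
  open Classical in
  if hs : 0 < s then
    ((a.scale (s ^ (4 / (n : ℝ))) (Real.rpow_pos_of_pos hs _) : Fiber g) : CompletedFiber g)
  else zeroPoint hg

/-- The parameter at which `brokenSegment` reaches `[0]`. -/
noncomputable def breakTime {n : ℕ} {g : Matrix (Fin n) (Fin n) ℝ} (a₀ a₁ : Fiber g) : ℝ :=
  fourthRootDet g a₀.mat / (fourthRootDet g a₀.mat + fourthRootDet g a₁.mat)

/-- The concatenation of the straight segments from `a₀` to `[0]` and from `[0]` to `a₁`,
parametrized on `[0,1]` proportionally to arc length. -/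
noncomputable def brokenSegment {n : ℕ} {g : Matrix (Fin n) (Fin n) ℝ} (hg : g.PosDef)
    (a₀ a₁ : Fiber g) (t : ℝ) : CompletedFiber g :=
  open Classical in
  if t ≤ breakTime a₀ a₁ then straight hg a₀ (1 - t / breakTime a₀ a₁)
  else straight hg a₁ ((t - breakTime a₀ a₁) / (1 - breakTime a₀ a₁))

/-- `γ` is a minimal path: between any two of its points its length is their distance. -/
def IsMinimalPath {X : Type*} [MetricSpace X] (γ : C(unitInterval, X)) : Prop :=
  ∀ s t : unitInterval, s ≤ t → eVariationOn γ (Set.Icc s t) = edist (γ s) (γ t)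

/-- `γ` is parametrized proportionally to arc length. -/
def IsProportionalToArcLength {X : Type*} [MetricSpace X] (γ : C(unitInterval, X)) : Prop :=
  ∀ s t : unitInterval, s ≤ t →
    eVariationOn γ (Set.Icc s t) = ENNReal.ofReal ((t : ℝ) - s) * eVariationOn γ Set.univ

/-- `γ` is a geodesic (minimal path) from `p` to `q`, parametrized on `[0,1]` proportionally
to arc length. -/
structure IsGeodesic {X : Type*} [MetricSpace X] (γ : C(unitInterval, X)) (p q : X) : Prop where
  minimal : IsMinimalPath γ
  proportional : IsProportionalToArcLength γ
  source : γ 0 = p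
  target : γ 1 = q

end MetricFiber

open MetricFiber

namespace MetricFiber

open Matrix

/-! ### Matrix logarithms and the exponential metric increasing property -/

section LinearAlgebra

variable {n : ℕ}

/-! The fiber is, up to the factor `4 / √n`, a metric cone. The radius is `(det A)^(1/4)`, the cross
section is the space of positive forms modulo scaling, and the angle `ang a b` is `√n / 4` times the
norm of the trace-free part of the logarithmic eigenvalues of `b` relative to `a`. The completion
adds the vertex `[0]`. Angles are cut off at `π`, because beyond `π` the shortest way runs through
the vertex. This is the distance formula `dist_eq_fiberConeDist`. Its upper bound comes from
explicit curves in a flat planar sector. Its lower bound comes from `fiberConeDist_sub_sq_le`, a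
finite-step inequality whose infinitesimal form is the Riemannian metric.

The cross section is nonpositively curved, and this enters only through `norm_chart_sub_le`: the
logarithmic chart at any point does not increase distances. It rests on `norm_matLog_sub_le`,
obtained by subdividing a curve and applying a trace inequality to each small piece.

A cone over such a space is again nonpositively curved. The form used is `IsBarycenter`: each pair
of points has, for each ratio, a point satisfying the CAT(0) comparison inequality with every `z`.
Below angle `π` that point lies on a straight segment in a planar sector, and the inequality is
`add_coneCos_le` read in the chart at that point. From angle `π` on it lies on the broken segment
through `[0]`, and the inequality is `coneCos_add_le_zero`. Barycenters survive passage to limits,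
so all pairs in the completion have them.

In any metric space, the comparison inequality forces a geodesic at time `t` to be the barycenter of
ratio `t`, and gives an estimate on the dependence on the endpoints that is uniform in `t`. This
yields uniqueness, continuity and the location of the path. The threshold is `ang = π`, rewritten
through `trProd_traceless_eq`. -/

theorem exists_orthogonal_diagonalization {A : Matrix (Fin n) (Fin n) ℝ} (hA : A.IsHermitian) :
    ∃ (U : Matrix (Fin n) (Fin n) ℝ) (d : Fin n → ℝ), U * Uᵀ = 1 ∧ A = U * diagonal d * Uᵀ := by
  refine ⟨(hA.eigenvectorUnitary : Matrix (Fin n) (Fin n) ℝ), hA.eigenvalues, ?_, ?_⟩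
  · simpa [star_eq_conjTranspose] using
      (mem_unitaryGroup_iff.1 hA.eigenvectorUnitary.2)
  · conv_lhs => rw [hA.spectral_theorem]
    simp [Unitary.conjStarAlgAut_apply, star_eq_conjTranspose]

theorem posDef_mul_diagonal_mul_transpose {F : Matrix (Fin n) (Fin n) ℝ} (hF : IsUnit F)
    {d : Fin n → ℝ} (hd : ∀ i, 0 < d i) : (F * diagonal d * Fᵀ).PosDef := by
  have := (hF.posDef_star_right_conjugate_iff (x := diagonal d)).2 (posDef_diagonal_iff.2 hd)
  simpa [star_eq_conjTranspose] using this

theorem isUnit_of_mul_transpose_eq_one {U : Matrix (Fin n) (Fin n) ℝ} (hU : U * Uᵀ = 1) :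
    IsUnit U := (isUnit_iff_isUnit_det _).2 (isUnit_det_of_right_inverse hU)

theorem isUnit_transpose' {F : Matrix (Fin n) (Fin n) ℝ} (hF : IsUnit F) : IsUnit Fᵀ := by
  rw [isUnit_iff_isUnit_det] at hF ⊢
  rwa [det_transpose]

theorem isUnit_diagonal {d : Fin n → ℝ} (hd : ∀ i, d i ≠ 0) : IsUnit (diagonal d) := by
  rw [isUnit_iff_isUnit_det, det_diagonal]
  exact (Finset.prod_ne_zero_iff.2 fun i _ => hd i).isUnit

theorem posDef_conj_iff {G a : Matrix (Fin n) (Fin n) ℝ} (hG : IsUnit G) :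
    (G * a * Gᵀ).PosDef ↔ a.PosDef := by
  have := hG.posDef_star_right_conjugate_iff (x := a)
  simpa [star_eq_conjTranspose] using this

theorem exists_eq_mul_transpose {a : Matrix (Fin n) (Fin n) ℝ} (ha : a.PosDef) :
    ∃ W, IsUnit W ∧ a = W * Wᵀ := by
  obtain ⟨U, d, hU, rfl⟩ := exists_orthogonal_diagonalization ha.1
  rw [posDef_conj_iff (isUnit_of_mul_transpose_eq_one hU), posDef_diagonal_iff] at ha
  refine ⟨U * diagonal fun i => √(d i), (isUnit_of_mul_transpose_eq_one hU).mul
    (isUnit_diagonal fun i => (Real.sqrt_pos.2 (ha i)).ne'), ?_⟩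
  rw [transpose_mul, diagonal_transpose, Matrix.mul_assoc U, Matrix.mul_assoc U (diagonal _),
    ← Matrix.mul_assoc (diagonal _) (diagonal _), diagonal_mul_diagonal]
  congr 3
  ext i
  exact (Real.mul_self_sqrt (ha i).le).symm

theorem inv_mul_mul_mul_transpose_inv {W : Matrix (Fin n) (Fin n) ℝ} (hW : IsUnit W)
    (b : Matrix (Fin n) (Fin n) ℝ) : W * (W⁻¹ * b * (W⁻¹)ᵀ) * Wᵀ = b := by
  have h : W * W⁻¹ = 1 := mul_nonsing_inv _ ((isUnit_iff_isUnit_det _).1 hW)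
  have h2 : (W⁻¹)ᵀ * Wᵀ = 1 := by rw [← transpose_mul, h, transpose_one]
  calc _ = (W * W⁻¹) * b * ((W⁻¹)ᵀ * Wᵀ) := by simp only [Matrix.mul_assoc]
    _ = b := by rw [h, h2, Matrix.one_mul, Matrix.mul_one]

/-- Simultaneous diagonalization of a positive definite and a symmetric form. -/
theorem exists_simultaneous_diagonalization {a b : Matrix (Fin n) (Fin n) ℝ} (ha : a.PosDef)
    (hb : b.IsHermitian) :
    ∃ (F : Matrix (Fin n) (Fin n) ℝ) (d : Fin n → ℝ), IsUnit F ∧ a = F * Fᵀ ∧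
      b = F * diagonal d * Fᵀ := by
  obtain ⟨W, hW, rfl⟩ := exists_eq_mul_transpose ha
  have hs : (W⁻¹ * b * (W⁻¹)ᵀ).IsHermitian := by
    have : bᵀ = b := by simpa using hb.eq
    simp [IsHermitian, this, Matrix.mul_assoc]
  obtain ⟨V, d, hV, hd⟩ := exists_orthogonal_diagonalization hs
  refine ⟨W * V, d, hW.mul (isUnit_of_mul_transpose_eq_one hV), ?_, ?_⟩
  · rw [transpose_mul, Matrix.mul_assoc, ← Matrix.mul_assoc V, hV, Matrix.one_mul]
  · conv_lhs => rw [← inv_mul_mul_mul_transpose_inv hW b, hd]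
    simp only [transpose_mul, Matrix.mul_assoc]

theorem exists_simultaneous_exp_diagonalization {a b : Matrix (Fin n) (Fin n) ℝ}
    (ha : a.PosDef) (hb : b.PosDef) :
    ∃ (F : Matrix (Fin n) (Fin n) ℝ) (l : Fin n → ℝ), IsUnit F ∧ a = F * Fᵀ ∧
      b = F * diagonal (fun i => Real.exp (l i)) * Fᵀ := by
  obtain ⟨F, d, hF, h1, h2⟩ := exists_simultaneous_diagonalization ha hb.1
  rw [h2, posDef_conj_iff hF, posDef_diagonal_iff] at hb
  exact ⟨F, fun i => Real.log (d i), hF, h1, by simp [h2, Real.exp_log (hb _)]⟩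

/-- The entries of a matrix as a vector; its norm is the Frobenius norm. -/
noncomputable def entryVec : Matrix (Fin n) (Fin n) ℝ →ₗ[ℝ] EuclideanSpace ℝ (Fin n × Fin n) where
  toFun X := WithLp.toLp 2 fun p => X p.1 p.2
  map_add' X Y := by ext p; simp
  map_smul' c X := by ext p; simp

theorem norm_entryVec_sq (X : Matrix (Fin n) (Fin n) ℝ) : ‖entryVec X‖ ^ 2 = (X * Xᵀ).trace := by
  rw [EuclideanSpace.norm_sq_eq, Fintype.sum_prod_type]
  simp [entryVec, trace, Matrix.mul_apply, sq]

/-- The weights are squares, hence nonnegative, so trace inequalities reduce to scalar inequalities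
for pairs of eigenvalues. -/
theorem trace_conj_diagonal_mul (U V : Matrix (Fin n) (Fin n) ℝ) (f h : Fin n → ℝ) :
    (U * diagonal f * Uᵀ * (V * diagonal h * Vᵀ)).trace
      = ∑ i, ∑ j, (Uᵀ * V) i j ^ 2 * (f i * h j) := by
  have : (U * diagonal f * Uᵀ * (V * diagonal h * Vᵀ)).trace
      = (diagonal f * (Uᵀ * V) * (diagonal h * (Uᵀ * V)ᵀ)).trace := by
    rw [Matrix.mul_assoc U, Matrix.mul_assoc U, trace_mul_comm U]
    simp only [transpose_mul, transpose_transpose, Matrix.mul_assoc]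
  rw [this]
  generalize Uᵀ * V = W
  simp only [trace, diag, Matrix.mul_apply (M := diagonal f * W), diagonal_mul, transpose_apply]
  refine Finset.sum_congr rfl fun i _ => Finset.sum_congr rfl fun j _ => by ring

/-- The right-hand side is `(2 sinh (x/2))²`, and `sinh` dominates the identity on nonnegative
reals. -/
theorem sq_le_exp_add_exp_neg (x : ℝ) : x ^ 2 ≤ Real.exp x + Real.exp (-x) - 2 := by
  have h1 : Real.exp x + Real.exp (-x) - 2 = (2 * Real.sinh (x / 2)) ^ 2 := by
    rw [Real.sinh_eq, show x = x / 2 + x / 2 by ring, Real.exp_add, show -(x / 2 + x / 2) =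
      -(x/2) + -(x/2) by ring, Real.exp_add]
    have : Real.exp (x / 2) * Real.exp (-(x / 2)) = 1 := by rw [← Real.exp_add]; simp
    ring_nf at this ⊢
    linarith
  rw [h1, sq_le_sq, abs_mul, Real.abs_sinh]
  have h2 : |x / 2| ≤ Real.sinh |x / 2| := Real.self_le_sinh_iff.2 (abs_nonneg _)
  rw [abs_div] at h2 ⊢
  rw [abs_two] at *
  linarith

theorem conj_diagonal_mul_conj_diagonal {U : Matrix (Fin n) (Fin n) ℝ} (hU : Uᵀ * U = 1)
    (d e : Fin n → ℝ) :
    U * diagonal d * Uᵀ * (U * diagonal e * Uᵀ) = U * diagonal (d * e) * Uᵀ := by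
  calc _ = U * diagonal d * (Uᵀ * U) * diagonal e * Uᵀ := by simp only [Matrix.mul_assoc]
    _ = _ := by rw [hU, Matrix.mul_one, Matrix.mul_assoc U, diagonal_mul_diagonal]; rfl

theorem inv_conj_exp_diagonal {U : Matrix (Fin n) (Fin n) ℝ} (hU : U * Uᵀ = 1)
    (l : Fin n → ℝ) : (U * diagonal (fun i => Real.exp (l i)) * Uᵀ)⁻¹ =
      U * diagonal (fun i => Real.exp (-l i)) * Uᵀ := by
  refine inv_eq_left_inv ?_
  rw [conj_diagonal_mul_conj_diagonal (mul_eq_one_comm.1 hU)]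
  have : ((fun i => Real.exp (-l i)) * fun i => Real.exp (l i)) = 1 := by
    ext i; simp [← Real.exp_add]
  rw [this, diagonal_one', Matrix.mul_one, hU]

/-- The Frobenius distance of two symmetric matrices is bounded in terms of their exponentials. -/
theorem norm_sub_sq_le_trace {U V : Matrix (Fin n) (Fin n) ℝ} (hU : U * Uᵀ = 1)
    (hV : V * Vᵀ = 1) (l m : Fin n → ℝ) :
    ‖entryVec (U * diagonal l * Uᵀ) - entryVec (V * diagonal m * Vᵀ)‖ ^ 2 ≤
      ((U * diagonal (fun i => Real.exp (l i)) * Uᵀ)⁻¹ *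
        (V * diagonal (fun i => Real.exp (m i)) * Vᵀ)).trace +
      ((V * diagonal (fun i => Real.exp (m i)) * Vᵀ)⁻¹ *
        (U * diagonal (fun i => Real.exp (l i)) * Uᵀ)).trace - 2 * n := by
  have hU' := mul_eq_one_comm.1 hU
  have hV' := mul_eq_one_comm.1 hV
  have symm : ∀ (W : Matrix (Fin n) (Fin n) ℝ) (d : Fin n → ℝ),
      (W * diagonal d * Wᵀ)ᵀ = W * diagonal d * Wᵀ := by
    intro W d; simp [Matrix.mul_assoc]
  have e1 : U * diagonal (1 : Fin n → ℝ) * Uᵀ = 1 := by rw [diagonal_one', Matrix.mul_one, hU]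
  have e2 : V * diagonal (1 : Fin n → ℝ) * Vᵀ = 1 := by rw [diagonal_one', Matrix.mul_one, hV]
  -- The identity is diagonal in both frames, so every term becomes a double sum with the same
  -- weights and the comparison can be made summand by summand.
  have h0 : (n : ℝ) = ∑ i, ∑ j, (Uᵀ * V) i j ^ 2 * (1 * 1) := by
    have := trace_conj_diagonal_mul U V 1 1
    rw [e1, e2, Matrix.mul_one, trace_one, Fintype.card_fin] at this
    simpa using this
  have h1 : (U * diagonal l * Uᵀ * (U * diagonal l * Uᵀ)).trace =
      ∑ i, ∑ j, (Uᵀ * V) i j ^ 2 * (l i * l i * 1) := by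
    have := trace_conj_diagonal_mul U V (l * l) 1
    rw [e2, Matrix.mul_one, ← conj_diagonal_mul_conj_diagonal hU'] at this
    simpa using this
  have h2 : (V * diagonal m * Vᵀ * (V * diagonal m * Vᵀ)).trace =
      ∑ i, ∑ j, (Uᵀ * V) i j ^ 2 * (1 * (m j * m j)) := by
    have := trace_conj_diagonal_mul U V 1 (m * m)
    rw [e1, Matrix.one_mul, ← conj_diagonal_mul_conj_diagonal hV'] at this
    simpa using this
  rw [inv_conj_exp_diagonal hU, inv_conj_exp_diagonal hV, trace_conj_diagonal_mul,
    trace_mul_comm (V * _ * _), trace_conj_diagonal_mul, ← map_sub, norm_entryVec_sq,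
    transpose_sub, symm, symm, Matrix.sub_mul, Matrix.mul_sub, Matrix.mul_sub, trace_sub,
    trace_sub, trace_sub, h1, h2, trace_mul_comm (V * _ * _), trace_conj_diagonal_mul, h0]
  simp only [← Finset.sum_sub_distrib, ← Finset.sum_add_distrib, Finset.mul_sum]
  refine Finset.sum_le_sum fun i _ => Finset.sum_le_sum fun j _ => ?_
  have := sq_le_exp_add_exp_neg (m j - l i)
  have h := mul_le_mul_of_nonneg_left this (sq_nonneg ((Uᵀ * V) i j))
  rw [← Real.exp_add, ← Real.exp_add, show -l i + m j = m j - l i by ring,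
    show l i + -m j = -(m j - l i) by ring]
  nlinarith

theorem exists_eq_conj_exp {a : Matrix (Fin n) (Fin n) ℝ} (ha : a.PosDef) :
    ∃ (U : Matrix (Fin n) (Fin n) ℝ) (l : Fin n → ℝ), U * Uᵀ = 1 ∧
      a = U * diagonal (fun i => Real.exp (l i)) * Uᵀ := by
  obtain ⟨U, d, hU, h⟩ := exists_orthogonal_diagonalization ha.1
  rw [h, posDef_conj_iff (isUnit_of_mul_transpose_eq_one hU), posDef_diagonal_iff] at ha
  exact ⟨U, fun i => Real.log (d i), hU, by simp [h, Real.exp_log (ha _)]⟩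

open Classical in
/-- The symmetric logarithm of a positive definite matrix. -/
noncomputable def matLog (a : Matrix (Fin n) (Fin n) ℝ) : Matrix (Fin n) (Fin n) ℝ :=
  if h : a.PosDef then (exists_eq_conj_exp h).choose *
    diagonal (exists_eq_conj_exp h).choose_spec.choose * ((exists_eq_conj_exp h).choose)ᵀ else 0

theorem matLog_spec {a : Matrix (Fin n) (Fin n) ℝ} (ha : a.PosDef) :
    ∃ (U : Matrix (Fin n) (Fin n) ℝ) (l : Fin n → ℝ), U * Uᵀ = 1 ∧
      a = U * diagonal (fun i => Real.exp (l i)) * Uᵀ ∧ matLog a = U * diagonal l * Uᵀ :=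
  ⟨_, _, (exists_eq_conj_exp ha).choose_spec.choose_spec.1,
    (exists_eq_conj_exp ha).choose_spec.choose_spec.2, by rw [matLog, dif_pos ha]⟩

/-- The bound is invariant under congruence and agrees to second order with the squared
affine-invariant length, so nothing is lost when it is summed over ever smaller steps. -/
theorem norm_matLog_sub_sq_le {a b : Matrix (Fin n) (Fin n) ℝ} (ha : a.PosDef) (hb : b.PosDef) :
    ‖entryVec (matLog a) - entryVec (matLog b)‖ ^ 2 ≤
      (a⁻¹ * b).trace + (b⁻¹ * a).trace - 2 * n := by
  obtain ⟨U, l, hU, e1, e2⟩ := matLog_spec ha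
  obtain ⟨V, m, hV, e3, e4⟩ := matLog_spec hb
  have := norm_sub_sq_le_trace hU hV l m
  rwa [← e1, ← e2, ← e3, ← e4] at this

theorem entryVec_injective : Function.Injective (entryVec (n := n)) := by
  intro X Y h
  ext i j
  exact congrArg (fun v : EuclideanSpace ℝ (Fin n × Fin n) => v (i, j)) h

/-- The diagonalization chosen in `matLog` is immaterial: for two diagonalizations of one matrix the
trace bound vanishes. -/
theorem matLog_conj_exp {U : Matrix (Fin n) (Fin n) ℝ} (hU : U * Uᵀ = 1) (l : Fin n → ℝ) :
    matLog (U * diagonal (fun i => Real.exp (l i)) * Uᵀ) = U * diagonal l * Uᵀ := by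
  set a := U * diagonal (fun i => Real.exp (l i)) * Uᵀ with ha
  have hp : a.PosDef := posDef_mul_diagonal_mul_transpose (isUnit_of_mul_transpose_eq_one hU)
    fun i => Real.exp_pos _
  obtain ⟨V, m, hV, e3, e4⟩ := matLog_spec hp
  have := norm_sub_sq_le_trace hV hU m l
  rw [← e3, ← ha, nonsing_inv_mul _ ((isUnit_iff_isUnit_det _).1 hp.isUnit), trace_one,
    Fintype.card_fin, ← e4] at this
  have h0 : ‖entryVec (matLog a) - entryVec (U * diagonal l * Uᵀ)‖ ^ 2 = 0 :=
    le_antisymm (this.trans (by linarith)) (sq_nonneg _)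
  rw [pow_eq_zero_iff two_ne_zero, norm_eq_zero, sub_eq_zero] at h0
  exact entryVec_injective h0

theorem trace_conj_orthogonal {U : Matrix (Fin n) (Fin n) ℝ} (hU : U * Uᵀ = 1)
    (X : Matrix (Fin n) (Fin n) ℝ) : (U * X * Uᵀ).trace = X.trace := by
  rw [trace_mul_comm, ← Matrix.mul_assoc, mul_eq_one_comm.1 hU, Matrix.one_mul]

theorem det_mul_transpose_of_orthogonal {U : Matrix (Fin n) (Fin n) ℝ} (hU : U * Uᵀ = 1) :
    U.det * U.det = 1 := by
  have := congrArg det hU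
  rwa [det_mul, det_transpose, det_one] at this

theorem trace_matLog {a : Matrix (Fin n) (Fin n) ℝ} (ha : a.PosDef) :
    (matLog a).trace = Real.log a.det := by
  obtain ⟨U, l, hU, e1, e2⟩ := matLog_spec ha
  have := det_mul_transpose_of_orthogonal hU
  have h : a.det = Real.exp (∑ i, l i) := by
    rw [e1, det_mul, det_mul, det_transpose, mul_right_comm, this, one_mul, det_diagonal,
      Real.exp_sum]
  rw [e2, trace_conj_orthogonal hU, trace_diagonal, h, Real.log_exp]

/-- Squeezed between `sq_le_exp_add_exp_neg` and `cosh y ≤ exp (y²/2)`. It gives the limit of the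
trace bounds over `N` equal steps. -/
theorem tendsto_sq_mul_exp_sub (x : ℝ) :
    Tendsto (fun N : ℕ => (N : ℝ) ^ 2 * (Real.exp (x / N) + Real.exp (-(x / N)) - 2)) atTop
      (𝓝 (x ^ 2)) := by
  have h1 : Tendsto (fun N : ℕ => (N : ℝ) ^ 2 * (2 * (Real.exp ((x / N) ^ 2 / 2) - 1))) atTop
      (𝓝 (x ^ 2)) := by
    by_cases hx : x = 0
    · simp [hx]
    have h2 : Tendsto (fun y : ℝ => y⁻¹ * (Real.exp y - 1)) (𝓝[≠] 0) (𝓝 1) := by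
      have := (Real.hasDerivAt_exp 0).tendsto_slope_zero
      simpa using this
    have h3 : Tendsto (fun N : ℕ => (x / N) ^ 2 / 2) atTop (𝓝[≠] 0) := by
      rw [tendsto_nhdsWithin_iff]
      constructor
      · have := ((tendsto_const_div_atTop_nhds_zero_nat x).pow 2).div_const 2
        simpa using this
      · filter_upwards [eventually_gt_atTop 0] with N hN
        have : (N : ℝ) ≠ 0 := by exact_mod_cast hN.ne'
        have : x / N ≠ 0 := div_ne_zero hx this
        simpa using ⟨hx, by simpa using hN.ne'⟩
    have h4 := (h2.comp h3).const_mul (x ^ 2)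
    rw [mul_one] at h4
    refine h4.congr' ?_
    filter_upwards [eventually_gt_atTop 0] with N hN
    have : (N : ℝ) ≠ 0 := by exact_mod_cast hN.ne'
    simp only [Function.comp]
    field_simp
  refine tendsto_of_tendsto_of_tendsto_of_le_of_le' tendsto_const_nhds h1 ?_ ?_
  · filter_upwards [eventually_gt_atTop 0] with N hN
    have hN' : (0 : ℝ) < N := by exact_mod_cast hN
    have := mul_le_mul_of_nonneg_left (sq_le_exp_add_exp_neg (x / N)) (sq_nonneg (N : ℝ))
    rwa [← mul_pow, mul_div_cancel₀ _ hN'.ne'] at this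
  · refine Eventually.of_forall fun N => ?_
    refine mul_le_mul_of_nonneg_left ?_ (sq_nonneg _)
    have := Real.cosh_le_exp_half_sq (x / N)
    rw [Real.cosh_eq] at this
    linarith

theorem trace_inv_mul_diagonal {G : Matrix (Fin n) (Fin n) ℝ} (hG : IsUnit G)
    {d e : Fin n → ℝ} (hd : ∀ i, d i ≠ 0) :
    ((G * diagonal d * Gᵀ)⁻¹ * (G * diagonal e * Gᵀ)).trace = ∑ i, e i / d i := by
  have hGt := isUnit_transpose' hG
  have h1 : G⁻¹ * G = 1 := nonsing_inv_mul _ ((isUnit_iff_isUnit_det _).1 hG)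
  have h2 : Gᵀ * (Gᵀ)⁻¹ = 1 := mul_nonsing_inv _ ((isUnit_iff_isUnit_det _).1 hGt)
  have hdi : (diagonal d)⁻¹ = diagonal fun i => (d i)⁻¹ := by
    refine inv_eq_left_inv ?_
    rw [diagonal_mul_diagonal, ← diagonal_one]
    congr 1; ext i; exact inv_mul_cancel₀ (hd i)
  rw [Matrix.mul_inv_rev, Matrix.mul_inv_rev, hdi]
  calc _ = ((Gᵀ)⁻¹ * ((diagonal fun i => (d i)⁻¹) * (G⁻¹ * G) * diagonal e * Gᵀ)).trace := by
        simp only [Matrix.mul_assoc]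
    _ = _ := by
      rw [h1, Matrix.mul_one, trace_mul_comm, Matrix.mul_assoc, h2, Matrix.mul_one,
        diagonal_mul_diagonal, trace_diagonal]
      exact Finset.sum_congr rfl fun i _ => by rw [div_eq_inv_mul]

/-- The exponential metric increasing property. -/
theorem norm_matLog_sub_le {G : Matrix (Fin n) (Fin n) ℝ} (hG : IsUnit G) (l : Fin n → ℝ) :
    ‖entryVec (matLog (G * diagonal (fun i => Real.exp (l i)) * Gᵀ)) -
      entryVec (matLog (G * Gᵀ))‖ ^ 2 ≤ ∑ i, l i ^ 2 := by
  set c : ℝ → Matrix (Fin n) (Fin n) ℝ := fun t =>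
    G * diagonal (fun i => Real.exp (t * l i)) * Gᵀ with hc
  have hpos : ∀ t, (c t).PosDef := fun t =>
    posDef_mul_diagonal_mul_transpose hG fun i => Real.exp_pos _
  -- Only `t - s` enters, so all steps of an equal subdivision have the same bound.
  have htr : ∀ s t, ((c s)⁻¹ * c t).trace = ∑ i, Real.exp ((t - s) * l i) := by
    intro s t
    rw [hc, trace_inv_mul_diagonal hG fun i => (Real.exp_pos _).ne']
    refine Finset.sum_congr rfl fun i _ => ?_
    rw [← Real.exp_sub, sub_mul]
  have hstep : ∀ s t, ‖entryVec (matLog (c t)) - entryVec (matLog (c s))‖ ≤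
      √(∑ i, (Real.exp ((t - s) * l i) + Real.exp (-((t - s) * l i)) - 2)) := by
    intro s t
    refine Real.le_sqrt_of_sq_le ((norm_matLog_sub_sq_le (hpos t) (hpos s)).trans_eq ?_)
    rw [htr, htr, Finset.sum_sub_distrib, Finset.sum_add_distrib]
    simp only [Finset.sum_const, Finset.card_univ, Fintype.card_fin, nsmul_eq_mul]
    rw [add_comm, mul_comm (n : ℝ)]
    simp only [← neg_mul, neg_sub]
  -- The triangle inequality over `N` equal steps gives `N * √q`, hence `N² * q` after squaring,
  -- which tends to the claimed bound.
  have hN : ∀ N : ℕ, 0 < N →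
      ‖entryVec (matLog (c 1)) - entryVec (matLog (c 0))‖ ^ 2 ≤
        ∑ i, (N : ℝ) ^ 2 * (Real.exp (l i / N) + Real.exp (-(l i / N)) - 2) := by
    intro N hN
    have hN' : (0 : ℝ) < N := by exact_mod_cast hN
    set q := ∑ i, (Real.exp (l i / N) + Real.exp (-(l i / N)) - 2) with hq
    have hq0 : 0 ≤ q := Finset.sum_nonneg fun i _ =>
      (sq_nonneg _).trans (sq_le_exp_add_exp_neg _)
    have hk : ∀ k : ℕ, ‖entryVec (matLog (c (k / N))) - entryVec (matLog (c 0))‖ ≤ k * √q := by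
      intro k
      induction k with
      | zero => simp
      | succ k ih =>
        have := hstep (k / N) ((k + 1 : ℕ) / N)
        have e : ((k + 1 : ℕ) : ℝ) / N - k / N = 1 / N := by push_cast; ring
        simp only [e, one_div_mul_eq_div] at this
        calc _ ≤ _ := norm_sub_le_norm_sub_add_norm_sub _ (entryVec (matLog (c (k / N)))) _
          _ ≤ √q + k * √q := add_le_add this ih
          _ = _ := by push_cast; ring
    have := hk N
    rw [div_self hN'.ne'] at this
    calc _ ≤ (N * √q) ^ 2 := pow_le_pow_left₀ (norm_nonneg _) this 2
      _ = _ := by rw [mul_pow, Real.sq_sqrt hq0, hq, Finset.mul_sum]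
  have hlim : Tendsto (fun N : ℕ => ∑ i, (N : ℝ) ^ 2 *
      (Real.exp (l i / N) + Real.exp (-(l i / N)) - 2)) atTop (𝓝 (∑ i, l i ^ 2)) :=
    tendsto_finsetSum _ fun i _ => tendsto_sq_mul_exp_sub (l i)
  have := ge_of_tendsto hlim (by filter_upwards [eventually_gt_atTop 0] with N h using hN N h)
  simpa [hc] using this

end LinearAlgebra

/-! ### Logarithmic charts, the angle and the radius -/

section Chart

variable {n : ℕ} {g : Matrix (Fin n) (Fin n) ℝ}

/-- The part of an endomorphism with trace zero. -/
noncomputable def traceFree (X : Matrix (Fin n) (Fin n) ℝ) : Matrix (Fin n) (Fin n) ℝ :=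
  X - (X.trace / n) • 1

theorem traceFree_sub (X Y : Matrix (Fin n) (Fin n) ℝ) :
    traceFree (X - Y) = traceFree X - traceFree Y := by
  simp only [traceFree, trace_sub, sub_div, sub_smul]; abel

theorem norm_entryVec_traceFree_sq (hn : 1 ≤ n) (X : Matrix (Fin n) (Fin n) ℝ) :
    ‖entryVec (traceFree X)‖ ^ 2 = ‖entryVec X‖ ^ 2 - X.trace ^ 2 / n := by
  have : (n : ℝ) ≠ 0 := by exact_mod_cast (by omega : n ≠ 0)
  simp only [norm_entryVec_sq, traceFree, transpose_sub, Matrix.sub_mul, Matrix.mul_sub,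
    transpose_smul, transpose_one, trace_sub, Matrix.mul_smul, Matrix.smul_mul, trace_smul,
    Matrix.mul_one, Matrix.one_mul, trace_transpose, smul_eq_mul, trace_one, Fintype.card_fin]
  field_simp
  ring

/-- A frame which is orthonormal for the inner product `a`. -/
noncomputable def Fiber.frame (a : Fiber g) : Matrix (Fin n) (Fin n) ℝ :=
  (exists_eq_mul_transpose a.posDef).choose

theorem Fiber.isUnit_frame (a : Fiber g) : IsUnit a.frame :=
  (exists_eq_mul_transpose a.posDef).choose_spec.1

theorem Fiber.frame_mul_transpose (a : Fiber g) : a.frame * a.frameᵀ = a.mat :=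
  (exists_eq_mul_transpose a.posDef).choose_spec.2.symm

theorem isUnit_inv' {F : Matrix (Fin n) (Fin n) ℝ} (hF : IsUnit F) : IsUnit F⁻¹ := by
  rw [isUnit_iff_isUnit_det] at hF ⊢
  exact isUnit_nonsing_inv_det F hF

/-- The matrix logarithm of `a` with respect to the frame at `w`. -/
noncomputable def logAt (w a : Fiber g) : Matrix (Fin n) (Fin n) ℝ :=
  matLog (w.frame⁻¹ * a.mat * (w.frame⁻¹)ᵀ)

/-- The trace free logarithm of `a` with respect to the frame at `w`, as a vector. -/
noncomputable def chart (w a : Fiber g) : EuclideanSpace ℝ (Fin n × Fin n) :=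
  entryVec (traceFree (logAt w a))

theorem Fiber.ext {a b : Fiber g} (h : a.mat = b.mat) : a = b := Subtype.ext h

theorem Fiber.exists_frame (a b : Fiber g) :
    ∃ (F : Matrix (Fin n) (Fin n) ℝ) (l : Fin n → ℝ), IsUnit F ∧ a.mat = F * Fᵀ ∧
      b.mat = F * diagonal (fun i => Real.exp (l i)) * Fᵀ :=
  exists_simultaneous_exp_diagonalization a.posDef b.posDef

/-- Two frames of the same form `w` differ by an orthogonal factor. One factor `O` serves all points
diagonal in `F`, so logarithms are linear in the exponents there. -/
theorem exists_logAt_eq (w : Fiber g) {F : Matrix (Fin n) (Fin n) ℝ}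
    (hw : w.mat = F * Fᵀ) : ∃ O : Matrix (Fin n) (Fin n) ℝ, O * Oᵀ = 1 ∧
      ∀ (a : Fiber g) (l : Fin n → ℝ), a.mat = F * diagonal (fun i => Real.exp (l i)) * Fᵀ →
        logAt w a = O * diagonal l * Oᵀ := by
  have h : w.frame⁻¹ * w.frame = 1 :=
    nonsing_inv_mul _ ((isUnit_iff_isUnit_det _).1 w.isUnit_frame)
  have hO : w.frame⁻¹ * F * (w.frame⁻¹ * F)ᵀ = 1 := by
    calc _ = w.frame⁻¹ * (F * Fᵀ) * (w.frame⁻¹)ᵀ := by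
          simp only [transpose_mul, Matrix.mul_assoc]
      _ = (w.frame⁻¹ * w.frame) * (w.frame⁻¹ * w.frame)ᵀ := by
          rw [← hw, ← w.frame_mul_transpose]; simp only [transpose_mul, Matrix.mul_assoc]
      _ = 1 := by rw [h]; simp
  refine ⟨_, hO, fun a l ha => ?_⟩
  rw [← matLog_conj_exp hO, logAt, ha]
  simp only [transpose_mul, Matrix.mul_assoc]

theorem traceFree_conj_diagonal {O : Matrix (Fin n) (Fin n) ℝ} (hO : O * Oᵀ = 1)
    (l : Fin n → ℝ) : traceFree (O * diagonal l * Oᵀ) =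
      O * diagonal (fun i => l i - (∑ j, l j) / n) * Oᵀ := by
  have : diagonal (fun i => l i - (∑ j, l j) / n) = diagonal l - ((∑ j, l j) / n) • 1 := by
    rw [smul_one_eq_diagonal, diagonal_sub]
  rw [this, traceFree, trace_conj_orthogonal hO, trace_diagonal, Matrix.mul_sub, Matrix.sub_mul,
    Matrix.mul_smul, Matrix.mul_one, Matrix.smul_mul, hO]

theorem norm_entryVec_conj_diagonal_sq {O : Matrix (Fin n) (Fin n) ℝ} (hO : O * Oᵀ = 1)
    (l : Fin n → ℝ) : ‖entryVec (O * diagonal l * Oᵀ)‖ ^ 2 = ∑ i, l i ^ 2 := by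
  have : (O * diagonal l * Oᵀ)ᵀ = O * diagonal l * Oᵀ := by simp [Matrix.mul_assoc]
  rw [norm_entryVec_sq, this, conj_diagonal_mul_conj_diagonal (mul_eq_one_comm.1 hO),
    trace_conj_orthogonal hO, trace_diagonal]
  exact Finset.sum_congr rfl fun i _ => by simp [sq]

theorem norm_chart_sq (hn : 1 ≤ n) {a b : Fiber g} {F : Matrix (Fin n) (Fin n) ℝ}
    {l : Fin n → ℝ} (ha : a.mat = F * Fᵀ)
    (hb : b.mat = F * diagonal (fun i => Real.exp (l i)) * Fᵀ) :
    ‖chart a b‖ ^ 2 = ∑ i, l i ^ 2 - (∑ i, l i) ^ 2 / n := by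
  obtain ⟨O, hO, h⟩ := exists_logAt_eq a ha
  rw [chart, norm_entryVec_traceFree_sq hn, h b l hb, norm_entryVec_conj_diagonal_sq hO,
    trace_conj_orthogonal hO, trace_diagonal]

theorem logAt_self (a : Fiber g) : logAt a a = 0 := by
  obtain ⟨O, hO, h⟩ := exists_logAt_eq a a.frame_mul_transpose.symm
  rw [h a 0 (by simp [a.frame_mul_transpose])]
  simp

theorem chart_self (a : Fiber g) : chart a a = 0 := by
  simp [chart, logAt_self, traceFree]

theorem posDef_inv_frame_conj (w a : Fiber g) :
    (w.frame⁻¹ * a.mat * (w.frame⁻¹)ᵀ).PosDef :=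
  (posDef_conj_iff (isUnit_inv' w.isUnit_frame)).2 a.posDef

theorem trace_logAt (w a : Fiber g) :
    (logAt w a).trace = Real.log a.mat.det - Real.log w.mat.det := by
  have h : w.mat.det = w.frame.det ^ 2 := by
    rw [← w.frame_mul_transpose, det_mul, det_transpose, sq]
  have h0 : w.frame.det ≠ 0 := ((isUnit_iff_isUnit_det _).1 w.isUnit_frame).ne_zero
  rw [logAt, trace_matLog (posDef_inv_frame_conj w a), det_mul, det_mul, det_transpose,
    det_nonsing_inv, Ring.inverse_eq_inv', ← Real.log_div a.posDef.det_pos.ne'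
    w.posDef.det_pos.ne', h]
  congr 1
  field_simp

theorem norm_chart_sub_sq (hn : 1 ≤ n) (w a b : Fiber g) : ‖chart w a - chart w b‖ ^ 2 =
    ‖entryVec (logAt w a) - entryVec (logAt w b)‖ ^ 2 -
      (Real.log a.mat.det - Real.log b.mat.det) ^ 2 / n := by
  rw [chart, chart, ← map_sub, ← traceFree_sub, norm_entryVec_traceFree_sq hn, map_sub, trace_sub,
    trace_logAt, trace_logAt]
  congr 2
  ring

/-- The frame at `w` cancels from the relative traces, so the bound does not depend on the base
point. -/
theorem norm_chart_sub_sq_le_trace (hn : 1 ≤ n) (w a b : Fiber g) :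
    ‖chart w a - chart w b‖ ^ 2 ≤ (a.mat⁻¹ * b.mat).trace + (b.mat⁻¹ * a.mat).trace - 2 * n -
      (Real.log a.mat.det - Real.log b.mat.det) ^ 2 / n := by
  rw [norm_chart_sub_sq hn]
  have := norm_matLog_sub_sq_le (posDef_inv_frame_conj w a) (posDef_inv_frame_conj w b)
  have key : ∀ x y : Fiber g, ((w.frame⁻¹ * x.mat * (w.frame⁻¹)ᵀ)⁻¹ *
      (w.frame⁻¹ * y.mat * (w.frame⁻¹)ᵀ)).trace = (x.mat⁻¹ * y.mat).trace := by
    intro x y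
    have hW := isUnit_inv' w.isUnit_frame
    set W := w.frame⁻¹
    have h1 : W⁻¹ * W = 1 := nonsing_inv_mul _ ((isUnit_iff_isUnit_det _).1 hW)
    have h2 : Wᵀ * (Wᵀ)⁻¹ = 1 :=
      mul_nonsing_inv _ ((isUnit_iff_isUnit_det _).1 (isUnit_transpose' hW))
    rw [Matrix.mul_inv_rev, Matrix.mul_inv_rev]
    calc _ = ((Wᵀ)⁻¹ * (x.mat⁻¹ * (W⁻¹ * W) * y.mat * Wᵀ)).trace := by
          simp only [Matrix.mul_assoc]
      _ = _ := by rw [h1, Matrix.mul_one, trace_mul_comm, Matrix.mul_assoc, h2, Matrix.mul_one]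
  rw [key, key] at this
  exact sub_le_sub_right this _

theorem log_det_sub (a b : Fiber g) {F : Matrix (Fin n) (Fin n) ℝ} {l : Fin n → ℝ}
    (hF : IsUnit F) (ha : a.mat = F * Fᵀ)
    (hb : b.mat = F * diagonal (fun i => Real.exp (l i)) * Fᵀ) :
    Real.log b.mat.det - Real.log a.mat.det = ∑ i, l i := by
  have h0 : F.det ≠ 0 := ((isUnit_iff_isUnit_det _).1 hF).ne_zero
  rw [ha, hb, det_mul, det_mul, det_mul, det_transpose, det_diagonal, ← Real.exp_sum,
    mul_right_comm, Real.log_mul (mul_ne_zero h0 h0) (Real.exp_pos _).ne', Real.log_exp]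
  ring

/-- Geodesic charts of the fiber do not increase distances. -/
theorem norm_chart_sub_le (hn : 1 ≤ n) (w a b : Fiber g) :
    ‖chart w a - chart w b‖ ≤ ‖chart a b‖ := by
  obtain ⟨F, l, hF, ha, hb⟩ := a.exists_frame b
  refine le_of_sq_le_sq ?_ (norm_nonneg _)
  rw [norm_chart_sub_sq hn, norm_chart_sq hn ha hb, ← log_det_sub a b hF ha hb, norm_sub_rev,
    ← neg_sub (Real.log b.mat.det), neg_sq]
  -- The metric increasing property for the frame `F` seen from `w`. The trace parts subtracted on
  -- the two sides coincide, since log-determinant differences do not depend on `w`.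
  have := norm_matLog_sub_le ((isUnit_inv' w.isUnit_frame).mul hF) l
  refine sub_le_sub_right ?_ _
  simpa only [logAt, ha, hb, transpose_mul, Matrix.mul_assoc] using this

/-- The angle between two points of the fiber, seen as points of a cone. -/
noncomputable def ang (a b : Fiber g) : ℝ := √n / 4 * ‖chart a b‖

theorem ang_nonneg (a b : Fiber g) : 0 ≤ ang a b := by unfold ang; positivity

theorem ang_self (a : Fiber g) : ang a a = 0 := by simp [ang, chart_self]

theorem norm_chart_comm (hn : 1 ≤ n) (a b : Fiber g) : ‖chart a b‖ = ‖chart b a‖ := by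
  refine le_antisymm ?_ ?_
  · simpa [chart_self] using norm_chart_sub_le hn a b a
  · simpa [chart_self] using norm_chart_sub_le hn b a b

theorem ang_comm (hn : 1 ≤ n) (a b : Fiber g) : ang a b = ang b a := by
  rw [ang, ang, norm_chart_comm hn]

theorem abs_ang_sub_le (w a b : Fiber g) :
    |ang w a - ang w b| ≤ √n / 4 * ‖chart w a - chart w b‖ := by
  rw [ang, ang, ← mul_sub, abs_mul, abs_of_nonneg (by positivity : 0 ≤ √(n : ℝ) / 4)]
  exact mul_le_mul_of_nonneg_left (abs_norm_sub_norm_le _ _) (by positivity)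

theorem ang_triangle (hn : 1 ≤ n) (a b c : Fiber g) : ang a c ≤ ang a b + ang b c := by
  have h1 := abs_ang_sub_le a c b
  have h2 := mul_le_mul_of_nonneg_left (norm_chart_sub_le hn a c b)
    (by positivity : 0 ≤ √(n : ℝ) / 4)
  have h3 := le_abs_self (ang a c - ang a b)
  rw [norm_chart_comm hn] at h2
  have : ang b c = √n / 4 * ‖chart b c‖ := rfl
  linarith

theorem relDet_pos (hg : g.PosDef) (a : Fiber g) : 0 < relDet g a.mat := by
  rw [relDet, det_mul, det_nonsing_inv, Ring.inverse_eq_inv']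
  exact mul_pos (inv_pos.2 hg.det_pos) a.posDef.det_pos

theorem fourthRootDet_pos (hg : g.PosDef) (a : Fiber g) : 0 < fourthRootDet g a.mat :=
  Real.rpow_pos_of_pos (relDet_pos hg a) _

theorem fourthRootDet_sq (hg : g.PosDef) (a : Fiber g) :
    fourthRootDet g a.mat ^ 2 = √(relDet g a.mat) := by
  rw [fourthRootDet, Real.sqrt_eq_rpow, ← Real.rpow_natCast, ← Real.rpow_mul (relDet_pos hg a).le]
  norm_num

theorem log_det_eq (hg : g.PosDef) (a : Fiber g) :
    Real.log a.mat.det = 4 * Real.log (fourthRootDet g a.mat) + Real.log g.det := by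
  rw [fourthRootDet, Real.log_rpow (relDet_pos hg a), relDet, det_mul, det_nonsing_inv,
    Ring.inverse_eq_inv', Real.log_mul (inv_pos.2 hg.det_pos).ne' a.posDef.det_pos.ne',
    Real.log_inv]
  ring

theorem fourthRootDet_eq_mul_exp (hg : g.PosDef) (a b : Fiber g)
    {F : Matrix (Fin n) (Fin n) ℝ} {l : Fin n → ℝ} (hF : IsUnit F) (ha : a.mat = F * Fᵀ)
    (hb : b.mat = F * diagonal (fun i => Real.exp (l i)) * Fᵀ) :
    fourthRootDet g b.mat = fourthRootDet g a.mat * Real.exp ((∑ i, l i) / 4) := by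
  have h := log_det_sub a b hF ha hb
  rw [log_det_eq hg, log_det_eq hg] at h
  rw [← Real.exp_log (fourthRootDet_pos hg b), ← Real.exp_log (fourthRootDet_pos hg a),
    ← Real.exp_add]
  congr 1
  linarith

/-- The point with matrix `F diag(exp l) Fᵀ`. -/
noncomputable def Fiber.ofFrame (g : Matrix (Fin n) (Fin n) ℝ) {F : Matrix (Fin n) (Fin n) ℝ}
    (hF : IsUnit F) (l : Fin n → ℝ) : Fiber g :=
  ⟨F * diagonal (fun i => Real.exp (l i)) * Fᵀ,
    posDef_mul_diagonal_mul_transpose hF fun _ => Real.exp_pos _⟩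

/-- The point which divides the angle from `a` to `b` in the ratio `τ : 1 - τ`. -/
theorem exists_chart_eq_smul (hn : 1 ≤ n) (hg : g.PosDef) (a b : Fiber g) (τ : ℝ) {ρ : ℝ}
    (hρ : 0 < ρ) : ∃ (m : Fiber g) (v : EuclideanSpace ℝ (Fin n × Fin n)),
      fourthRootDet g m.mat = ρ ∧ chart m a = -(τ • v) ∧ chart m b = (1 - τ) • v ∧
      √n / 4 * ‖v‖ = ang a b := by
  have hn' : (n : ℝ) ≠ 0 := by exact_mod_cast (by omega : n ≠ 0)
  obtain ⟨F, l, hF, ha, hb⟩ := a.exists_frame b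
  -- A common shift of the exponents changes only the radius; this one makes it `ρ`.
  set c := (4 / n : ℝ) * (Real.log ρ - Real.log (fourthRootDet g a.mat)) - τ * (∑ i, l i) / n
    with hc
  let p : Fin n → ℝ := fun i => τ * l i + c
  let m : Fiber g := Fiber.ofFrame g hF p
  have hmm : m.mat = F * diagonal (fun i => Real.exp (p i)) * Fᵀ := rfl
  -- A frame orthonormal for `m`, in which `a` and `b` have exponents `-p` and `l - p`. Their
  -- trace-free parts are `-τ` and `1 - τ` times that of `l`.
  let F' := F * diagonal fun i => Real.exp (p i / 2)
  have hF' : ∀ q : Fin n → ℝ, F' * diagonal (fun i => Real.exp (q i)) * F'ᵀ =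
      F * diagonal (fun i => Real.exp (p i + q i)) * Fᵀ := by
    intro q
    simp only [F', transpose_mul, diagonal_transpose]
    rw [Matrix.mul_assoc F, diagonal_mul_diagonal, Matrix.mul_assoc, ← Matrix.mul_assoc (diagonal _),
      diagonal_mul_diagonal, ← Matrix.mul_assoc]
    congr 3
    ext i
    rw [← Real.exp_add, ← Real.exp_add]
    congr 1
    ring
  have hm : m.mat = F' * F'ᵀ := by
    have := hF' 0
    simpa [hmm] using this.symm
  have ha' : a.mat = F' * diagonal (fun i => Real.exp (-p i)) * F'ᵀ := by
    rw [hF' fun i => -p i, ha]; simp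
  have hb' : b.mat = F' * diagonal (fun i => Real.exp (l i - p i)) * F'ᵀ := by
    rw [hF' fun i => l i - p i, hb]; simp
  obtain ⟨O, hO, h⟩ := exists_logAt_eq m hm
  have hps : ∑ i, p i = τ * ∑ i, l i + n * c := by
    simp [p, Finset.sum_add_distrib, Finset.mul_sum]
  refine ⟨m, entryVec (O * diagonal (fun i => l i - (∑ j, l j) / n) * Oᵀ), ?_, ?_, ?_, ?_⟩
  · rw [fourthRootDet_eq_mul_exp hg a m hF ha hmm, hps, hc]
    have : (τ * ∑ i, l i + n * ((4 / n : ℝ) * (Real.log ρ - Real.log (fourthRootDet g a.mat)) -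
      τ * (∑ i, l i) / n)) / 4 = Real.log ρ - Real.log (fourthRootDet g a.mat) := by
      field_simp; ring
    rw [this, Real.exp_sub, Real.exp_log hρ, Real.exp_log (fourthRootDet_pos hg a),
      mul_div_cancel₀ _ (fourthRootDet_pos hg a).ne']
  · rw [chart, h a _ ha', traceFree_conj_diagonal hO, ← map_smul, ← map_neg]
    congr 1
    rw [← neg_smul, ← Matrix.smul_mul, ← Matrix.mul_smul, ← diagonal_smul]
    congr 3
    ext i
    simp only [Finset.sum_neg_distrib, hps, Pi.smul_apply, smul_eq_mul, p]
    field_simp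
    ring
  · rw [chart, h b _ hb', traceFree_conj_diagonal hO, ← map_smul]
    congr 1
    rw [← Matrix.smul_mul, ← Matrix.mul_smul, ← diagonal_smul]
    congr 3
    ext i
    simp only [Finset.sum_sub_distrib, hps, Pi.smul_apply, smul_eq_mul, p]
    field_simp
    ring
  · rw [ang]
    congr 1
    rw [← sq_eq_sq₀ (norm_nonneg _) (norm_nonneg _), norm_chart_sq hn ha hb, ←
      traceFree_conj_diagonal hO, norm_entryVec_traceFree_sq hn, norm_entryVec_conj_diagonal_sq hO,
      trace_conj_orthogonal hO, trace_diagonal]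

/-- Scaling shifts all relative logarithmic eigenvalues by `log s`, which the trace-free part does
not see. -/
theorem norm_chart_scale_left (hn : 1 ≤ n) (a b : Fiber g) {s : ℝ} (hs : 0 < s) :
    ‖chart (a.scale s hs) b‖ = ‖chart a b‖ := by
  have hn' : (n : ℝ) ≠ 0 := by exact_mod_cast (by omega : n ≠ 0)
  obtain ⟨F, l, hF, ha, hb⟩ := a.exists_frame b
  have h1 : (a.scale s hs).mat = (√s • F) * (√s • F)ᵀ := by
    rw [transpose_smul, Matrix.smul_mul, Matrix.mul_smul, smul_smul, Real.mul_self_sqrt hs.le,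
      ← ha]
    rfl
  have h2 : b.mat = (√s • F) * diagonal (fun i => Real.exp (l i - Real.log s)) * (√s • F)ᵀ := by
    have : diagonal (fun i => Real.exp (l i - Real.log s)) =
        s⁻¹ • diagonal (fun i => Real.exp (l i)) := by
      rw [← diagonal_smul]
      congr 1; ext i
      simp [Real.exp_sub, Real.exp_log hs, div_eq_inv_mul]
    rw [transpose_smul, Matrix.smul_mul, Matrix.smul_mul, Matrix.mul_smul, smul_smul,
      Real.mul_self_sqrt hs.le, this, Matrix.mul_smul, Matrix.smul_mul, smul_smul,
      mul_inv_cancel₀ hs.ne', one_smul, hb]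
  rw [← sq_eq_sq₀ (norm_nonneg _) (norm_nonneg _), norm_chart_sq hn h1 h2, norm_chart_sq hn ha hb]
  simp only [sub_sq, Finset.sum_add_distrib, Finset.sum_sub_distrib, Finset.sum_const,
    Finset.card_univ, Fintype.card_fin, nsmul_eq_mul, ← Finset.sum_mul, ← Finset.mul_sum]
  field_simp
  ring

theorem ang_scale_left (hn : 1 ≤ n) (a b : Fiber g) {s : ℝ} (hs : 0 < s) :
    ang (a.scale s hs) b = ang a b := by rw [ang, ang, norm_chart_scale_left hn]

theorem ang_scale_right (hn : 1 ≤ n) (a b : Fiber g) {s : ℝ} (hs : 0 < s) :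
    ang a (b.scale s hs) = ang a b := by rw [ang_comm hn, ang_scale_left hn, ang_comm hn]

/-- The tensor `s^(4/n) a`, whose radius is `s` times that of `a`. -/
noncomputable def Fiber.dilate (a : Fiber g) (s : ℝ) (hs : 0 < s) : Fiber g :=
  a.scale (s ^ (4 / (n : ℝ))) (Real.rpow_pos_of_pos hs _)

theorem fourthRootDet_dilate (hn : 1 ≤ n) (hg : g.PosDef) (a : Fiber g) {s : ℝ} (hs : 0 < s) :
    fourthRootDet g (a.dilate s hs).mat = s * fourthRootDet g a.mat := by
  have hn' : (n : ℝ) ≠ 0 := by exact_mod_cast (by omega : n ≠ 0)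
  have h1 : relDet g (a.dilate s hs).mat = s ^ 4 * relDet g a.mat := by
    have : (s ^ (4 / (n : ℝ))) ^ n = s ^ 4 := by
      rw [← Real.rpow_natCast, ← Real.rpow_mul hs.le, div_mul_cancel₀ _ hn']
      exact_mod_cast Real.rpow_natCast s 4
    have h2 : (a.dilate s hs).mat = (s ^ (4 / (n : ℝ))) • a.mat := rfl
    simp [relDet, h2, this]
  rw [fourthRootDet, h1, Real.mul_rpow (by positivity) (relDet_pos hg a).le, ← Real.rpow_natCast,
    ← Real.rpow_mul hs.le, fourthRootDet]
  norm_num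

end Chart

/-! ### Trigonometric inequalities behind the curvature of a cone -/

section ConeTrigonometry

/-- The cosine, cut off at `π`. -/
noncomputable def coneCos (x : ℝ) : ℝ := Real.cos (min Real.pi x)

theorem coneCos_of_le {x : ℝ} (hx : x ≤ Real.pi) : coneCos x = Real.cos x := by
  rw [coneCos, min_eq_right hx]

theorem coneCos_of_ge {x : ℝ} (hx : Real.pi ≤ x) : coneCos x = -1 := by
  rw [coneCos, min_eq_left hx, Real.cos_pi]

theorem coneCos_le_one (x : ℝ) : coneCos x ≤ 1 := Real.cos_le_one _

theorem coneCos_antitone {x y : ℝ} (hx : 0 ≤ x) (h : x ≤ y) : coneCos y ≤ coneCos x :=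
  Real.cos_le_cos_of_nonneg_of_le_pi (le_min Real.pi_pos.le hx) (min_le_left _ _)
    (min_le_min_left _ h)

/-- By monotonicity, `y ≥ π - x` has cosine at most `-cos x`. This is the comparison inequality for
paths through the vertex. -/
theorem coneCos_add_le_zero {x y : ℝ} (hx : 0 ≤ x) (h : Real.pi ≤ x + y) :
    coneCos x + coneCos y ≤ 0 := by
  rcases le_total Real.pi x with h1 | h1
  · rw [coneCos_of_ge h1]; linarith [coneCos_le_one y]
  have h2 : coneCos y ≤ coneCos (Real.pi - x) := coneCos_antitone (by linarith) (by linarith)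
  rw [coneCos_of_le (by linarith : Real.pi - x ≤ Real.pi), Real.cos_pi_sub] at h2
  rw [coneCos_of_le h1]; linarith

/-- Slopes of chords from the origin decrease for the concave sine. -/
theorem sin_div_antitone {x y : ℝ} (hx : 0 < x) (h : x ≤ y) (hy : y ≤ Real.pi) :
    Real.sin y / y ≤ Real.sin x / x := by
  have hy0 : 0 < y := hx.trans_le h
  have := strictConcaveOn_sin_Icc.concaveOn.2 (Set.left_mem_Icc.2 Real.pi_pos.le)
    (⟨hy0.le, hy⟩ : y ∈ Set.Icc 0 Real.pi) 
    (by rw [sub_nonneg, div_le_one hy0]; exact h : 0 ≤ 1 - x / y)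
    (by positivity : 0 ≤ x / y) (by ring)
  simp only [smul_eq_mul, Real.sin_zero, mul_zero, zero_add, div_mul_cancel₀ _ hy0.ne'] at this
  rw [div_le_div_iff₀ hy0 hx]
  rw [div_mul_eq_mul_div, div_le_iff₀ hy0] at this
  linarith

theorem convexOn_cos_sqrt : ConvexOn ℝ (Set.Icc 0 (Real.pi ^ 2)) fun q => Real.cos √q := by
  have hint : interior (Set.Icc 0 (Real.pi ^ 2)) = Set.Ioo 0 (Real.pi ^ 2) := interior_Icc
  have hd : ∀ q ∈ Set.Ioo 0 (Real.pi ^ 2),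
      HasDerivAt (fun q => Real.cos √q) (-(Real.sin √q / √q) / 2) q := by
    intro q hq
    have := (Real.hasDerivAt_sqrt hq.1.ne').cos
    convert this using 1
    ring
  refine MonotoneOn.convexOn_of_deriv (convex_Icc _ _) (by fun_prop) ?_ ?_
  · rw [hint]; exact fun q hq => (hd q hq).differentiableAt.differentiableWithinAt
  · rw [hint]
    intro p hp q hq h
    rw [(hd p hp).deriv, (hd q hq).deriv]
    have := sin_div_antitone (Real.sqrt_pos.2 hp.1) (Real.sqrt_le_sqrt h)
      (by rw [Real.sqrt_le_left Real.pi_pos.le]; exact hq.2.le)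
    linarith

/-- The cutoff replaces `q` by the concave `min (π²) q`, and a decreasing convex function of a
concave one is convex. -/
theorem convexOn_coneCos_sqrt : ConvexOn ℝ (Set.Ici 0) fun q => coneCos √q := by
  have himg : (fun q : ℝ => min (Real.pi ^ 2) q) '' Set.Ici 0 = Set.Icc 0 (Real.pi ^ 2) := by
    ext x
    constructor
    · rintro ⟨q, hq, rfl⟩
      exact ⟨le_min (by positivity) hq, min_le_left _ _⟩
    · exact fun h => ⟨x, h.1, min_eq_right h.2⟩
  have hconc : ConcaveOn ℝ (Set.Ici (0 : ℝ)) fun q => min (Real.pi ^ 2) q :=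
    (concaveOn_const _ (convex_Ici 0)).inf (concaveOn_id (convex_Ici 0))
  have hanti : AntitoneOn (fun q => Real.cos √q) (Set.Icc 0 (Real.pi ^ 2)) := by
    intro p hp q hq h
    exact Real.cos_le_cos_of_nonneg_of_le_pi (Real.sqrt_nonneg _)
      (by rw [Real.sqrt_le_left Real.pi_pos.le]; exact hq.2) (Real.sqrt_le_sqrt h)
  have := ConvexOn.comp_concaveOn (himg ▸ convexOn_cos_sqrt) hconc (himg ▸ hanti)
  refine this.congr fun q _ => ?_
  have hm : √(min (Real.pi ^ 2) q) = min Real.pi √q := by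
    rcases le_total (Real.pi ^ 2) q with h | h
    · rw [min_eq_left h, Real.sqrt_sq Real.pi_pos.le, min_eq_left (Real.le_sqrt_of_sq_le h)]
    · rw [min_eq_right h, min_eq_right ((Real.sqrt_le_left Real.pi_pos.le).2 h)]
  simp only [Function.comp, hm, coneCos]

/-- The third side of a triangle in the plane is at least the third side of the spherical
triangle with the same two sides and angle. -/
theorem coneCos_sqrt_le {x y s : ℝ} (hx : 0 ≤ x) (hx' : x ≤ Real.pi) (hy : 0 ≤ y)
    (hy' : y ≤ Real.pi) (hs : |s| ≤ 1) :
    coneCos √(x ^ 2 + y ^ 2 - 2 * (x * y * s)) ≤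
      Real.cos x * Real.cos y + Real.sin x * Real.sin y * s := by
  obtain ⟨h1, h2⟩ := abs_le.1 hs
  -- With weights `(1 ± s)/2`, the squared planar side interpolates `(x - y)²` and `(x + y)²`, while
  -- the spherical cosine interpolates `cos (x - y)` and `cos (x + y)`.
  have key := convexOn_coneCos_sqrt.2 (Set.mem_Ici.2 (sq_nonneg (x - y)))
    (Set.mem_Ici.2 (sq_nonneg (x + y))) 
    (by linarith : 0 ≤ (1 + s) / 2) (by linarith : 0 ≤ (1 - s) / 2) (by ring)
  simp only [smul_eq_mul] at key
  have e : (1 + s) / 2 * (x - y) ^ 2 + (1 - s) / 2 * (x + y) ^ 2 =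
      x ^ 2 + y ^ 2 - 2 * (x * y * s) := by ring
  rw [e, Real.sqrt_sq_eq_abs, Real.sqrt_sq (add_nonneg hx hy)] at key
  have e1 : coneCos |x - y| = Real.cos (x - y) := by
    rw [coneCos_of_le (abs_le.2 ⟨by linarith, by linarith⟩), Real.cos_abs]
  have e2 : coneCos (x + y) ≤ Real.cos (x + y) := by
    rcases le_total (x + y) Real.pi with h | h
    · rw [coneCos_of_le h]
    · rw [coneCos_of_ge h]; exact Real.neg_one_le_cos _
  rw [Real.cos_add] at e2
  rw [e1, Real.cos_sub] at key
  have := mul_le_mul_of_nonneg_left e2 (by linarith : 0 ≤ (1 - s) / 2)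
  nlinarith

variable {V : Type*} [NormedAddCommGroup V] [InnerProductSpace ℝ V]

theorem sinc_mul_self (x : ℝ) : Real.sinc x * x = Real.sin x := by
  rcases eq_or_ne x 0 with rfl | h
  · simp
  · rw [Real.sinc_of_ne_zero h, div_mul_cancel₀ _ h]

/-- Vector form of `coneCos_sqrt_le`. Writing `sinc` makes the bound linear in the inner product and
covers zero vectors. -/
theorem coneCos_norm_sub_le {w u : V} (hw : ‖w‖ ≤ Real.pi) (hu : ‖u‖ ≤ Real.pi) :
    coneCos ‖w - u‖ ≤ Real.cos ‖w‖ * Real.cos ‖u‖ +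
      Real.sinc ‖w‖ * Real.sinc ‖u‖ * inner ℝ w u := by
  set s := inner ℝ w u / (‖w‖ * ‖u‖) with hs
  have h1 : ‖w‖ * ‖u‖ * s = inner ℝ w u := by
    by_cases h : ‖w‖ * ‖u‖ = 0
    · have := abs_real_inner_le_norm w u
      rw [h] at this ⊢
      rw [abs_nonpos_iff.1 this, zero_mul]
    · rw [hs, mul_div_cancel₀ _ h]
  have h2 := coneCos_sqrt_le (norm_nonneg w) hw (norm_nonneg u) hu
    (abs_real_inner_div_norm_mul_norm_le_one w u)
  have h3 : ‖w - u‖ = √(‖w‖ ^ 2 + ‖u‖ ^ 2 - 2 * (‖w‖ * ‖u‖ * s)) := by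
    rw [h1, ← Real.sqrt_sq (norm_nonneg (w - u)), norm_sub_sq_real]
    congr 1; ring
  rw [h3]
  refine h2.trans_eq ?_
  rw [← hs, ← h1, ← sinc_mul_self ‖w‖, ← sinc_mul_self ‖u‖]
  ring

theorem coneCos_norm_sub_le_of_pi_le {V : Type*} [SeminormedAddCommGroup V] {w u : V} (hw : Real.pi ≤ ‖w‖) (hu : ‖u‖ ≤ Real.pi) :
    coneCos ‖w - u‖ ≤ -Real.cos ‖u‖ := by
  have h := norm_sub_norm_le w u
  have := coneCos_antitone (x := Real.pi - ‖u‖) (by linarith) (y := ‖w - u‖) (by linarith)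
  rwa [coneCos_of_le (by linarith [norm_nonneg u] : Real.pi - ‖u‖ ≤ Real.pi), Real.cos_pi_sub] at this

/-- The cone over a Euclidean space is nonpositively curved: concavity of the product of the
radius and the cosine of the angle along a segment. -/
theorem add_coneCos_le {w v : V} {τ A B ρ α β : ℝ} (hτ : τ ∈ Set.Icc (0 : ℝ) 1)
    (hv : ‖v‖ < Real.pi) (hA : 0 ≤ A) (hB : 0 ≤ B)
    (hcos : A * Real.cos (τ * ‖v‖) + B * Real.cos ((1 - τ) * ‖v‖) = ρ)
    (hsin : A * Real.sin (τ * ‖v‖) = B * Real.sin ((1 - τ) * ‖v‖))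
    (hα : ‖w + τ • v‖ ≤ α) (hβ : ‖w - (1 - τ) • v‖ ≤ β) :
    A * coneCos α + B * coneCos β ≤ ρ * coneCos ‖w‖ := by
  have hτ' : 0 ≤ 1 - τ := by linarith [hτ.2]
  have n1 : ‖-(τ • v)‖ = τ * ‖v‖ := by rw [norm_neg, norm_smul, Real.norm_of_nonneg hτ.1]
  have n2 : ‖(1 - τ) • v‖ = (1 - τ) * ‖v‖ := by rw [norm_smul, Real.norm_of_nonneg hτ']
  have l1 : ‖-(τ • v)‖ ≤ Real.pi := by
    rw [n1]; nlinarith [norm_nonneg v, hτ.2]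
  have l2 : ‖(1 - τ) • v‖ ≤ Real.pi := by
    rw [n2]; nlinarith [norm_nonneg v, hτ.1]
  rw [← sub_neg_eq_add] at hα
  have a1 := mul_le_mul_of_nonneg_left (coneCos_antitone (norm_nonneg _) hα) hA
  have a2 := mul_le_mul_of_nonneg_left (coneCos_antitone (norm_nonneg _) hβ) hB
  rcases le_total Real.pi ‖w‖ with hw | hw
  · have b1 := mul_le_mul_of_nonneg_left (coneCos_norm_sub_le_of_pi_le hw l1) hA
    have b2 := mul_le_mul_of_nonneg_left (coneCos_norm_sub_le_of_pi_le hw l2) hB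
    rw [n1] at b1
    rw [n2] at b2
    rw [coneCos_of_ge hw]
    linarith
  · have b1 := mul_le_mul_of_nonneg_left (coneCos_norm_sub_le hw l1) hA
    have b2 := mul_le_mul_of_nonneg_left (coneCos_norm_sub_le hw l2) hB
    rw [n1, inner_neg_right, inner_smul_right] at b1
    rw [n2, inner_smul_right] at b2
    -- The balance `hsin` makes the inner product terms of the two estimates cancel.
    have e : A * (Real.sinc (τ * ‖v‖) * (τ * inner ℝ w v)) =
        B * (Real.sinc ((1 - τ) * ‖v‖) * ((1 - τ) * inner ℝ w v)) := by
      by_cases h : ‖v‖ = 0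
      · rw [norm_eq_zero.1 h]; simp
      · rw [← sinc_mul_self (τ * ‖v‖), ← sinc_mul_self ((1 - τ) * ‖v‖)] at hsin
        refine mul_left_cancel₀ h ?_
        linear_combination (inner ℝ w v : ℝ) * hsin
    rw [coneCos_of_le hw, ← hcos]
    linear_combination a1 + a2 + b1 + b2 - Real.sinc ‖w‖ * e

/-- Polar coordinates of a nonzero point of a segment in a plane sector. -/
theorem exists_polar {A B θ : ℝ} (hA : 0 ≤ A) (hB : 0 ≤ B) (hAB : 0 < A + B) (hθ : 0 ≤ θ)
    (hθ' : θ < Real.pi) : ∃ τ ∈ Set.Icc (0 : ℝ) 1, ∃ ρ > 0,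
      ρ ^ 2 = A ^ 2 + B ^ 2 + 2 * A * B * Real.cos θ ∧
      A * Real.cos (τ * θ) + B * Real.cos ((1 - τ) * θ) = ρ ∧
      A * Real.sin (τ * θ) = B * Real.sin ((1 - τ) * θ) := by
  have hs0 : 0 ≤ Real.sin θ := Real.sin_nonneg_of_nonneg_of_le_pi hθ hθ'.le
  -- The direction of the vector sum of sides `A` and `B` is where their transverse components
  -- balance.
  obtain ⟨τ, hτ, h0⟩ : (0 : ℝ) ∈ (fun τ => A * Real.sin (τ * θ) - B * Real.sin ((1 - τ) * θ)) ''
      Set.Icc 0 1 := by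
    refine intermediate_value_Icc zero_le_one (by fun_prop) ⟨?_, ?_⟩
    · simp; positivity
    · simp; positivity
  have hsin : A * Real.sin (τ * θ) = B * Real.sin ((1 - τ) * θ) := sub_eq_zero.1 h0
  set x := τ * θ
  set y := (1 - τ) * θ with hy
  have hxy : θ = x + y := by simp only [x, y]; ring
  have hx0 : 0 ≤ Real.sin x := Real.sin_nonneg_of_nonneg_of_le_pi (mul_nonneg hτ.1 hθ)
    (by simp only [x]; nlinarith [hτ.2])
  have hy0 : 0 ≤ Real.sin y := Real.sin_nonneg_of_nonneg_of_le_pi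
    (mul_nonneg (by linarith [hτ.2]) hθ) (by rw [hy]; nlinarith [hτ.1])
  refine ⟨τ, hτ, A * Real.cos x + B * Real.cos y, ?_, ?_, rfl, hsin⟩
  · rcases hθ.eq_or_lt with h | h
    · simp only [x, y, ← h]; simpa using hAB
    · have hs : 0 < (A + B) * Real.sin θ := mul_pos hAB (Real.sin_pos_of_pos_of_lt_pi h hθ')
      -- This identity, valid under the balance, gives positivity without knowing the signs of the
      -- cosines.
      have e : (A * Real.cos x + B * Real.cos y) * (Real.sin x + Real.sin y) =
          (A + B) * Real.sin θ := by
        rw [hxy, Real.sin_add]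
        linear_combination (Real.cos x - Real.cos y) * hsin
      rw [← e] at hs
      exact pos_of_mul_pos_left hs (add_nonneg hx0 hy0)
  · rw [hxy, Real.cos_add]
    have h1 := Real.sin_sq_add_cos_sq x
    have h2 := Real.sin_sq_add_cos_sq y
    linear_combination A ^ 2 * h1 + B ^ 2 * h2 -
      (A * Real.sin x - B * Real.sin y) * hsin

end ConeTrigonometry

/-! ### Geodesics in metric spaces with CAT(0) barycenters -/

section Barycenter

variable {X : Type*} [MetricSpace X]

/-- `m` divides the pair `p, q` in the ratio `t : 1 - t`, in the sense of the comparison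
inequality of nonpositive curvature. -/
def IsBarycenter (p q : X) (t : ℝ) (m : X) : Prop :=
  ∀ z, dist z m ^ 2 ≤ (1 - t) * dist z p ^ 2 + t * dist z q ^ 2 - t * (1 - t) * dist p q ^ 2

variable {p q p' q' m m' : X} {t : ℝ}

theorem IsBarycenter.dist_left (h : IsBarycenter p q t m) (ht : 0 ≤ t) :
    dist m p ≤ t * dist p q := by
  refine le_of_sq_le_sq ?_ (by positivity)
  have := h p
  rw [dist_self, dist_comm p m] at this
  linarith

theorem IsBarycenter.dist_right (h : IsBarycenter p q t m) (ht : t ≤ 1) :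
    dist m q ≤ (1 - t) * dist p q := by
  refine le_of_sq_le_sq ?_ (mul_nonneg (by linarith) dist_nonneg)
  have := h q
  rw [dist_self, dist_comm q m, dist_comm q p] at this
  linarith

/-- Barycenters depend continuously on the pair of points. -/
theorem IsBarycenter.dist_sq_le (h : IsBarycenter p q t m) (ht : t ∈ Set.Icc (0 : ℝ) 1)
    (h1 : dist m' p' ≤ t * dist p' q') (h2 : dist m' q' ≤ (1 - t) * dist p' q') :
    dist m' m ^ 2 ≤ dist p q * (2 * (dist p p' + dist q q')) +
      (2 * (dist p p' + dist q q')) ^ 2 := by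
  have ht0 := ht.1
  have ht1 : 0 ≤ 1 - t := by linarith [ht.2]
  set e := dist p p' + dist q q' with he
  set D := dist p q with hD
  have hD0 : 0 ≤ D := dist_nonneg
  have a1 : 0 ≤ dist p p' := dist_nonneg
  have a2 : 0 ≤ dist q q' := dist_nonneg
  have he0 : 0 ≤ e := add_nonneg a1 a2
  have hD' : dist p' q' ≤ D + e := by
    have b1 := dist_triangle p' p q'
    have b2 := dist_triangle p q q'
    rw [dist_comm p' p] at b1
    linarith
  have c1 : dist m' p ≤ t * D + 2 * e := by
    have b1 := dist_triangle m' p' p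
    rw [dist_comm p' p] at b1
    have := mul_le_mul_of_nonneg_left hD' ht0
    nlinarith
  have c2 : dist m' q ≤ (1 - t) * D + 2 * e := by
    have b1 := dist_triangle m' q' q
    rw [dist_comm q' q] at b1
    have := mul_le_mul_of_nonneg_left hD' ht1
    nlinarith
  have d1 : dist m' p ^ 2 ≤ (t * D + 2 * e) ^ 2 := pow_le_pow_left₀ dist_nonneg c1 2
  have d2 : dist m' q ^ 2 ≤ ((1 - t) * D + 2 * e) ^ 2 := pow_le_pow_left₀ dist_nonneg c2 2
  have e1 := mul_le_mul_of_nonneg_left d1 ht1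
  have e2 := mul_le_mul_of_nonneg_left d2 ht0
  have h3 := h m'
  -- This removes `t` from the final bound, which later makes convergence of geodesics uniform.
  have h4 : 4 * (t * (1 - t)) ≤ 1 := by nlinarith [sq_nonneg (2 * t - 1)]
  have h5 := mul_le_mul_of_nonneg_right h4 (mul_nonneg hD0 (mul_nonneg two_pos.le he0))
  calc dist m' m ^ 2 ≤ (1 - t) * (t * D + 2 * e) ^ 2 + t * ((1 - t) * D + 2 * e) ^ 2 -
        t * (1 - t) * D ^ 2 := by linarith
    _ = 4 * (t * (1 - t)) * (D * (2 * e)) + (2 * e) ^ 2 := by ring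
    _ ≤ _ := by linarith

theorem IsBarycenter.unique (h : IsBarycenter p q t m) (ht : t ∈ Set.Icc (0 : ℝ) 1)
    (h1 : dist m' p ≤ t * dist p q) (h2 : dist m' q ≤ (1 - t) * dist p q) : m' = m := by
  have := h.dist_sq_le ht h1 h2
  simp only [dist_self, add_zero, mul_zero, ne_eq, OfNat.ofNat_ne_zero, not_false_eq_true,
    zero_pow] at this
  exact dist_eq_zero.1 (pow_eq_zero_iff two_ne_zero |>.1 (le_antisymm this (sq_nonneg _)))

theorem tendsto_barycenter_bound {ι : Type*} {l : Filter ι} {α β : ι → X}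
    (hα : Tendsto α l (𝓝 p)) (hβ : Tendsto β l (𝓝 q)) :
    Tendsto (fun k => dist p q * (2 * (dist p (α k) + dist q (β k))) +
      (2 * (dist p (α k) + dist q (β k))) ^ 2) l (𝓝 0) := by
  have h1 : Tendsto (fun k => 2 * (dist p (α k) + dist q (β k))) l (𝓝 0) := by
    have := ((tendsto_const_nhds (x := p)).dist hα).add ((tendsto_const_nhds (x := q)).dist hβ)
    simpa using this.const_mul 2
  simpa using (h1.const_mul (dist p q)).add (h1.pow 2)

theorem IsBarycenter.of_dense {S : Set X} (hS : Dense S)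
    (h : ∀ z ∈ S, dist z m ^ 2 ≤ (1 - t) * dist z p ^ 2 + t * dist z q ^ 2 -
      t * (1 - t) * dist p q ^ 2) : IsBarycenter p q t m := by
  intro z
  have hc : IsClosed {z | dist z m ^ 2 ≤ (1 - t) * dist z p ^ 2 + t * dist z q ^ 2 -
      t * (1 - t) * dist p q ^ 2} := isClosed_le (by fun_prop) (by fun_prop)
  exact hc.closure_subset_iff.2 h (hS z)

/-- By `IsBarycenter.dist_sq_le`, barycenters of approximating pairs form a Cauchy sequence, and the
comparison inequality is closed under limits. -/
theorem exists_isBarycenter_of_dense [CompleteSpace X] {S : Set X} (hS : Dense S)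
    (ht : t ∈ Set.Icc (0 : ℝ) 1) (h : ∀ p ∈ S, ∀ q ∈ S, ∃ m, IsBarycenter p q t m) (p q : X) :
    ∃ m, IsBarycenter p q t m := by
  obtain ⟨α, hα, hαp⟩ := mem_closure_iff_seq_limit.1 (hS p)
  obtain ⟨β, hβ, hβq⟩ := mem_closure_iff_seq_limit.1 (hS q)
  choose m hm using fun k => h (α k) (hα k) (β k) (hβ k)
  have hc : CauchySeq m := by
    rw [Metric.cauchySeq_iff]
    intro ε hε
    have h1 : Tendsto (fun x : ℕ × ℕ => 2 * (dist (α x.1) (α x.2) + dist (β x.1) (β x.2)))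
        atTop (𝓝 0) := by
      have h2 := hαp.comp (tendsto_fst (f := atTop) (g := (atTop : Filter ℕ)))
      have h3 := hαp.comp (tendsto_snd (f := (atTop : Filter ℕ)) (g := atTop))
      have h4 := hβq.comp (tendsto_fst (f := atTop) (g := (atTop : Filter ℕ)))
      have h5 := hβq.comp (tendsto_snd (f := (atTop : Filter ℕ)) (g := atTop))
      rw [← prod_atTop_atTop_eq]
      simpa using ((h2.dist h3).add (h4.dist h5)).const_mul 2
    have h6 : Tendsto (fun x : ℕ × ℕ => dist (α x.1) (β x.1)) atTop (𝓝 (dist p q)) := by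
      rw [← prod_atTop_atTop_eq]
      exact (hαp.comp tendsto_fst).dist (hβq.comp tendsto_fst)
    have h7 := (h6.mul h1).add (h1.pow 2)
    rw [mul_zero, zero_pow two_ne_zero, add_zero] at h7
    obtain ⟨N, hN⟩ := eventually_atTop.1 (h7.eventually_lt_const (pow_pos hε 2))
    refine ⟨max N.1 N.2, fun k hk l hl => ?_⟩
    have h8 := hN (k, l) ⟨(le_max_left _ _).trans hk, (le_max_right _ _).trans hl⟩
    have h9 := (hm k).dist_sq_le ht ((hm l).dist_left ht.1) ((hm l).dist_right ht.2)
    rw [dist_comm]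
    exact lt_of_pow_lt_pow_left₀ 2 hε.le (h9.trans_lt h8)
  obtain ⟨m₀, hm₀⟩ := cauchySeq_tendsto_of_complete hc
  refine ⟨m₀, fun z => ?_⟩
  refine le_of_tendsto_of_tendsto' ((tendsto_const_nhds.dist hm₀).pow 2) ?_ fun k => hm k z
  have a1 := ((tendsto_const_nhds (x := z)).dist hαp).pow 2
  have a2 := ((tendsto_const_nhds (x := z)).dist hβq).pow 2
  have a3 := (hαp.dist hβq).pow 2
  exact ((a1.const_mul _).add (a2.const_mul _)).sub (a3.const_mul _)

/-- Testing at `m'` gives the coefficient `(1 - t)s² + t(1 - s)² - t(1 - t) = (t - s)²`. -/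
theorem IsBarycenter.dist_le {s : ℝ} (h : IsBarycenter p q t m) (h' : IsBarycenter p q s m')
    (ht : t ∈ Set.Icc (0 : ℝ) 1) (hs : s ∈ Set.Icc (0 : ℝ) 1) :
    dist m' m ≤ |t - s| * dist p q := by
  refine le_of_sq_le_sq ?_ (by positivity)
  have h1 := pow_le_pow_left₀ dist_nonneg (h'.dist_left hs.1) 2
  have h2 := pow_le_pow_left₀ dist_nonneg (h'.dist_right hs.2) 2
  have h3 := mul_le_mul_of_nonneg_left h1 (by linarith [ht.2] : 0 ≤ 1 - t)
  have h4 := mul_le_mul_of_nonneg_left h2 ht.1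
  have h5 := h m'
  rw [mul_pow, sq_abs]
  nlinarith

/-- The Lipschitz bound limits the variation from above, the two endpoints from below. -/
theorem eVariationOn_Icc_of_dist_eq {γ : C(unitInterval, X)} {D : ℝ} (hD : 0 ≤ D)
    (h : ∀ s t : unitInterval, dist (γ s) (γ t) = |(t : ℝ) - s| * D) {s t : unitInterval}
    (hst : s ≤ t) : eVariationOn γ (Set.Icc s t) = ENNReal.ofReal (((t : ℝ) - s) * D) := by
  refine le_antisymm ?_ ?_
  · have hl : LipschitzOnWith (Real.toNNReal D) (Set.IccExtend zero_le_one γ : ℝ → X)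
        (Set.Icc 0 1) := by
      refine LipschitzOnWith.of_dist_le_mul fun x hx y hy => ?_
      rw [Set.IccExtend_of_mem _ _ hx, Set.IccExtend_of_mem _ _ hy, h, Real.coe_toNNReal _ hD,
        mul_comm, Real.dist_eq, abs_sub_comm]
    have h1 := hl.comp_eVariationOn_le (g := ((↑) : unitInterval → ℝ)) (s := Set.Icc s t)
      fun x _ => x.2
    have h2 : (Set.IccExtend zero_le_one γ : ℝ → X) ∘ ((↑) : unitInterval → ℝ) = γ := by
      ext x; simp
    have h3 : eVariationOn ((↑) : unitInterval → ℝ) (Set.Icc s t) =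
        ENNReal.ofReal ((t : ℝ) - s) := by
      have := MonotoneOn.eVariationOn_eq (f := ((↑) : unitInterval → ℝ)) (s := Set.Icc s t)
        (fun x _ y _ hxy => hxy) (Set.left_mem_Icc.2 hst) (Set.right_mem_Icc.2 hst)
      rwa [Set.inter_self] at this
    rw [h2, h3] at h1
    refine h1.trans_eq ?_
    rw [mul_comm, ENNReal.ofReal_mul (sub_nonneg.2 hst)]
    rfl
  · have := eVariationOn.edist_le γ (Set.left_mem_Icc.2 hst) (Set.right_mem_Icc.2 hst)
    rwa [edist_dist, h, abs_of_nonneg (sub_nonneg.2 (Subtype.coe_le_coe.2 hst))] at this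

theorem IsGeodesic.edist_eq {γ : C(unitInterval, X)} (hγ : IsGeodesic γ p q)
    {s t : unitInterval} (hst : s ≤ t) :
    edist (γ s) (γ t) = ENNReal.ofReal ((t : ℝ) - s) * edist p q := by
  have h1 : eVariationOn γ Set.univ = edist p q := by
    have := hγ.minimal 0 1 zero_le_one
    rw [hγ.source, hγ.target] at this
    rw [← this]
    congr 1
    ext x
    exact iff_of_true trivial ⟨x.2.1, x.2.2⟩
  rw [← hγ.minimal s t hst, hγ.proportional s t hst, h1]

theorem IsGeodesic.dist_eq {γ : C(unitInterval, X)} (hγ : IsGeodesic γ p q)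
    {s t : unitInterval} (hst : s ≤ t) :
    dist (γ s) (γ t) = ((t : ℝ) - s) * dist p q := by
  have := hγ.edist_eq hst
  have h0 : (0 : ℝ) ≤ (t : ℝ) - s := sub_nonneg.2 hst
  rw [edist_dist, edist_dist, ← ENNReal.ofReal_mul h0,
    ENNReal.ofReal_eq_ofReal_iff dist_nonneg (by positivity)] at this
  exact this

theorem IsGeodesic.dist_left {γ : C(unitInterval, X)} (hγ : IsGeodesic γ p q)
    (t : unitInterval) : dist (γ t) p = t * dist p q := by
  have := hγ.dist_eq (s := 0) (t := t) t.2.1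
  rw [hγ.source, dist_comm] at this
  simpa using this

theorem IsGeodesic.dist_right {γ : C(unitInterval, X)} (hγ : IsGeodesic γ p q)
    (t : unitInterval) : dist (γ t) q = (1 - t) * dist p q := by
  have := hγ.dist_eq (s := t) (t := 1) t.2.2
  rw [hγ.target] at this
  simpa using this

theorem IsGeodesic.eq_of_isBarycenter {γ : C(unitInterval, X)} (hγ : IsGeodesic γ p q)
    (t : unitInterval) (h : IsBarycenter p q t m) : γ t = m :=
  h.unique t.2 (hγ.dist_left t).le (hγ.dist_right t).le

/-- The barycenters of varying ratio themselves form the geodesic. -/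
theorem existsUnique_isGeodesic
    (h : ∀ t ∈ Set.Icc (0 : ℝ) 1, ∃ m, IsBarycenter p q t m) :
    ∃! γ : C(unitInterval, X), IsGeodesic γ p q := by
  choose m hm using fun t : unitInterval => h t t.2
  have hle : ∀ s t : unitInterval, dist (m s) (m t) ≤ |(t : ℝ) - s| * dist p q :=
    fun s t => (hm t).dist_le (hm s) t.2 s.2
  have hcont : Continuous m := by
    have : LipschitzWith (Real.toNNReal (dist p q)) m :=
      LipschitzWith.of_dist_le_mul fun s t => by
        rw [Real.coe_toNNReal _ dist_nonneg, mul_comm, Subtype.dist_eq, Real.dist_eq,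
          abs_sub_comm]
        exact hle s t
    exact this.continuous
  have h0 : m 0 = p := by
    have := (hm 0).dist_left le_rfl
    exact dist_le_zero.1 (by simpa using this)
  have h1 : m 1 = q := by
    have := (hm 1).dist_right le_rfl
    exact dist_le_zero.1 (by simpa using this)
  have heq' : ∀ s t : unitInterval, s ≤ t → dist (m s) (m t) = ((t : ℝ) - s) * dist p q := by
    intro s t hst
    have a1 := hle s t
    rw [abs_of_nonneg (sub_nonneg.2 (Subtype.coe_le_coe.2 hst))] at a1
    refine le_antisymm a1 ?_
    -- Were `m s` and `m t` closer, the route `p, m s, m t, q` would be shorter than `dist p q`.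
    have a2 := dist_triangle p (m s) q
    have a3 := dist_triangle (m s) (m t) q
    have a4 := (hm s).dist_left s.2.1
    have a5 := (hm t).dist_right t.2.2
    rw [dist_comm] at a4
    linarith
  have heq : ∀ s t : unitInterval, dist (m s) (m t) = |(t : ℝ) - s| * dist p q := by
    intro s t
    rcases le_total s t with hst | hst
    · rw [heq' s t hst, abs_of_nonneg (sub_nonneg.2 (Subtype.coe_le_coe.2 hst))]
    · rw [dist_comm, heq' t s hst, abs_sub_comm,
        abs_of_nonneg (sub_nonneg.2 (Subtype.coe_le_coe.2 hst))]
  have hvar : ∀ s t : unitInterval, s ≤ t → eVariationOn m (Set.Icc s t) =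
      ENNReal.ofReal (((t : ℝ) - s) * dist p q) := fun s t hst =>
    eVariationOn_Icc_of_dist_eq (γ := ⟨m, hcont⟩) dist_nonneg heq hst
  refine ⟨⟨m, hcont⟩, ⟨fun s t hst => ?_, fun s t hst => ?_, h0, h1⟩, fun γ hγ => ?_⟩
  · rw [ContinuousMap.coe_mk, hvar s t hst, edist_dist, heq' s t hst]
  · have hu : (Set.univ : Set unitInterval) = Set.Icc 0 1 := by
      ext x
      exact iff_of_true trivial ⟨x.2.1, x.2.2⟩
    rw [ContinuousMap.coe_mk, hvar s t hst, hu, hvar 0 1 zero_le_one,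
      ENNReal.ofReal_mul (sub_nonneg.2 (Subtype.coe_le_coe.2 hst))]
    simp
  · ext t
    exact hγ.eq_of_isBarycenter t (hm t)

theorem tendsto_isGeodesic (h : ∀ t ∈ Set.Icc (0 : ℝ) 1, ∃ m, IsBarycenter p q t m)
    {α β : ℕ → X} {γ : ℕ → C(unitInterval, X)} {γ' : C(unitInterval, X)}
    (hα : Tendsto α atTop (𝓝 p)) (hβ : Tendsto β atTop (𝓝 q))
    (hγ : ∀ k, IsGeodesic (γ k) (α k) (β k)) (hγ' : IsGeodesic γ' p q) :
    Tendsto γ atTop (𝓝 γ') := by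
  rw [Metric.tendsto_nhds]
  intro ε hε
  filter_upwards [(tendsto_barycenter_bound hα hβ).eventually_lt_const (pow_pos hε 2)] with k hk
  rw [ContinuousMap.dist_lt_iff hε]
  intro t
  obtain ⟨m, hm⟩ := h t t.2
  rw [hγ'.eq_of_isBarycenter t hm]
  exact lt_of_pow_lt_pow_left₀ 2 hε.le
    ((hm.dist_sq_le t.2 ((hγ k).dist_left t).le ((hγ k).dist_right t).le).trans_lt hk)

end Barycenter

/-! ### Upper bound for the distance by explicit curves -/

section UpperBound

variable {n : ℕ} {g : Matrix (Fin n) (Fin n) ℝ}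

theorem inv_mul_conj_diagonal {F : Matrix (Fin n) (Fin n) ℝ} (hF : IsUnit F)
    {d e : Fin n → ℝ} (hd : ∀ i, d i ≠ 0) :
    (F * diagonal d * Fᵀ)⁻¹ * (F * diagonal (e * d) * Fᵀ) = (Fᵀ)⁻¹ * diagonal e * Fᵀ := by
  have h1 : F⁻¹ * F = 1 := nonsing_inv_mul _ ((isUnit_iff_isUnit_det _).1 hF)
  have hdi : (diagonal d)⁻¹ = diagonal fun i => (d i)⁻¹ := by
    refine inv_eq_left_inv ?_
    rw [diagonal_mul_diagonal, ← diagonal_one]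
    congr 1; ext i; exact inv_mul_cancel₀ (hd i)
  rw [Matrix.mul_inv_rev, Matrix.mul_inv_rev, hdi]
  calc _ = (Fᵀ)⁻¹ * ((diagonal fun i => (d i)⁻¹) * (F⁻¹ * F) * diagonal (e * d)) * Fᵀ := by
        simp only [Matrix.mul_assoc]
    _ = _ := by
      rw [h1, Matrix.mul_one, diagonal_mul_diagonal]
      congr 3
      ext i
      simp only [Pi.mul_apply]
      field_simp [hd i]

theorem trProd_conj_diagonal {F : Matrix (Fin n) (Fin n) ℝ} (hF : IsUnit F)
    {d e : Fin n → ℝ} (hd : ∀ i, d i ≠ 0) :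
    trProd (F * diagonal d * Fᵀ) (F * diagonal (e * d) * Fᵀ) (F * diagonal (e * d) * Fᵀ) =
      ∑ i, e i ^ 2 := by
  have h2 : Fᵀ * (Fᵀ)⁻¹ = 1 :=
    mul_nonsing_inv _ ((isUnit_iff_isUnit_det _).1 (isUnit_transpose' hF))
  rw [trProd, inv_mul_conj_diagonal hF hd]
  calc _ = ((Fᵀ)⁻¹ * (diagonal e * (Fᵀ * (Fᵀ)⁻¹) * diagonal e * Fᵀ)).trace := by
        simp only [Matrix.mul_assoc]
    _ = _ := by
      rw [h2, Matrix.mul_one, trace_mul_comm, Matrix.mul_assoc, h2, Matrix.mul_one,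
        diagonal_mul_diagonal, trace_diagonal]
      exact Finset.sum_congr rfl fun i _ => (sq _).symm

theorem conj_diagonal_apply (F : Matrix (Fin n) (Fin n) ℝ) (d : Fin n → ℝ) (i j : Fin n) :
    (F * diagonal d * Fᵀ) i j = ∑ k, F i k * d k * F j k := by
  simp only [Matrix.mul_apply (M := F * diagonal d), mul_diagonal, transpose_apply]

/-- In a fixed frame the squared speed is `∑ l'²` times the squared radius. A speed bound on the
unit interval bounds the length. -/
theorem dist_le_of_diagonal_arc (hg : g.PosDef) {F : Matrix (Fin n) (Fin n) ℝ} (hF : IsUnit F)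
    {l l' : ℝ → Fin n → ℝ} (hl : ∀ i, ContDiffOn ℝ 1 (fun t => l t i) (Set.Icc 0 1))
    (hl' : ∀ t ∈ Set.Icc (0 : ℝ) 1, ∀ i,
      HasDerivWithinAt (fun t => l t i) (l' t i) (Set.Icc 0 1) t)
    {a b : Fiber g} (ha : a = Fiber.ofFrame g hF (l 0)) (hb : b = Fiber.ofFrame g hF (l 1))
    {C : ℝ} (hC : 0 ≤ C) (hle : ∀ t ∈ Set.Icc (0 : ℝ) 1,
      (∑ i, l' t i ^ 2) * fourthRootDet g (Fiber.ofFrame g hF (l t)).mat ^ 2 ≤ C ^ 2) :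
    dist a b ≤ C := by
  let c : C1Arc a b :=
    { toFun := fun t => F * diagonal (fun i => Real.exp (l t i)) * Fᵀ
      contDiffOn := fun i j => by
        simp only [conj_diagonal_apply]
        exact ContDiffOn.sum fun k _ => (contDiffOn_const.mul (hl k).exp).mul contDiffOn_const
      posDef := fun t _ => (Fiber.ofFrame g hF (l t)).posDef
      source := by rw [ha]; rfl
      target := by rw [hb]; rfl }
  have hv : ∀ t ∈ Set.Icc (0 : ℝ) 1, velocity c.toFun t =
      F * diagonal (l' t * fun i => Real.exp (l t i)) * Fᵀ := by
    intro t ht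
    ext i j
    rw [conj_diagonal_apply, velocity, of_apply]
    simp only [c, conj_diagonal_apply]
    refine HasDerivWithinAt.derivWithin ?_ (uniqueDiffOn_Icc zero_lt_one t ht)
    refine HasDerivWithinAt.fun_sum fun k _ => ?_
    refine ((((hl' t ht k).exp).const_mul (F i k)).mul_const (F j k)).congr_deriv ?_
    simp only [Pi.mul_apply]
    ring
  have hlen : c.length ≤ C := by
    have := intervalIntegral.norm_integral_le_of_norm_le_const (a := 0) (b := 1) (C := C)
      (f := fun t => riemNorm g (c.toFun t) (velocity c.toFun t)) fun t ht => by
        rw [Set.uIoc_of_le zero_le_one] at ht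
        have ht' : t ∈ Set.Icc (0 : ℝ) 1 := ⟨ht.1.le, ht.2⟩
        rw [Real.norm_of_nonneg (show 0 ≤ riemNorm g _ _ from Real.sqrt_nonneg _), riemNorm, Real.sqrt_le_left hC, riemInner,
          hv t ht', trProd_conj_diagonal hF fun i => (Real.exp_pos _).ne']
        have h1 := fourthRootDet_sq hg (Fiber.ofFrame g hF (l t))
        have h2 := hle t ht'
        rw [h1] at h2
        exact h2
    rw [sub_zero, abs_one, mul_one] at this
    exact (le_abs_self _).trans this
  have := riemDist_le (.cons c (.nil b))
  rw [PiecewiseC1Path.length, PiecewiseC1Path.length, add_zero] at this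
  exact this.trans hlen

/-- The length scale of the cone. -/
noncomputable def coneScale (n : ℕ) : ℝ := 4 / √n

theorem coneScale_pos (hn : 1 ≤ n) : 0 < coneScale n := by
  have : (0 : ℝ) < n := by exact_mod_cast hn
  unfold coneScale; positivity

theorem coneScale_sq (n : ℕ) : coneScale n ^ 2 = 16 / n := by
  rw [coneScale, div_pow, Real.sq_sqrt (Nat.cast_nonneg n)]; norm_num

theorem ang_sq_eq (hn : 1 ≤ n) (a b : Fiber g) : coneScale n ^ 2 * ang a b ^ 2 =
    ‖chart a b‖ ^ 2 := by
  have : (0 : ℝ) < n := by exact_mod_cast hn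
  rw [ang, coneScale]; field_simp

/-- Scaling and the trace-free direction from `a` to `b` span a flat planar sector. The competing
curve is the complex segment from `r` to `s e^{iθ}`, pulled back by the complex logarithm; for `θ <
π` it stays in the slit plane. -/
theorem dist_le_of_ang_lt_pi (hn : 1 ≤ n) (hg : g.PosDef) (a b : Fiber g)
    (h : ang a b < Real.pi) : dist a b ≤ coneScale n *
      √(fourthRootDet g a.mat ^ 2 + fourthRootDet g b.mat ^ 2 -
        2 * fourthRootDet g a.mat * fourthRootDet g b.mat * Real.cos (ang a b)) := by
  have hn' : (0 : ℝ) < n := by exact_mod_cast hn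
  obtain ⟨F, l, hF, ha, hb⟩ := a.exists_frame b
  set r := fourthRootDet g a.mat with hr
  set s := fourthRootDet g b.mat with hs
  set θ := ang a b with hθ
  have hr0 : 0 < r := fourthRootDet_pos hg a
  have hs0 : 0 < s := fourthRootDet_pos hg b
  have hθ0 : 0 ≤ θ := ang_nonneg a b
  have hsr : Real.log s = Real.log r + (∑ i, l i) / 4 := by
    rw [hs, fourthRootDet_eq_mul_exp hg a b hF ha hb, Real.log_mul hr0.ne' (Real.exp_pos _).ne',
      Real.log_exp]
  let p : Fin n → ℝ := fun i => l i - (∑ j, l j) / n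
  have hp0 : ∑ i, p i = 0 := by
    simp only [p, Finset.sum_sub_distrib, Finset.sum_const, Finset.card_univ, Fintype.card_fin,
      nsmul_eq_mul]
    field_simp
    ring
  have hp2 : ∑ i, p i ^ 2 = 16 / n * θ ^ 2 := by
    rw [← coneScale_sq, hθ, ang_sq_eq hn, norm_chart_sq hn ha hb]
    simp only [p, sub_sq, Finset.sum_add_distrib, Finset.sum_sub_distrib, Finset.sum_const,
      Finset.card_univ, Fintype.card_fin, nsmul_eq_mul, ← Finset.sum_mul, ← Finset.mul_sum]
    field_simp
    ring
  let w : ℂ := s * Complex.exp (θ * Complex.I) - r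
  let z : ℝ → ℂ := fun t => r + t * w
  have hzre : ∀ t, (z t).re = (1 - t) * r + t * s * Real.cos θ := by
    intro t
    simp [z, w, Complex.exp_ofReal_mul_I_re]
    ring
  have hzim : ∀ t, (z t).im = t * s * Real.sin θ := by
    intro t
    simp [z, w, Complex.exp_ofReal_mul_I_im]
    ring
  have hslit : ∀ t ∈ Set.Icc (0 : ℝ) 1, z t ∈ Complex.slitPlane := by
    intro t ht
    rw [Complex.mem_slitPlane_iff, hzre, hzim]
    rcases hθ0.eq_or_lt with h0 | h0
    · left
      rw [← h0, Real.cos_zero, mul_one]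
      exact convex_Ioi (0 : ℝ) hr0 hs0 (by linarith [ht.2]) ht.1 (by ring)
    · rcases ht.1.eq_or_lt with h1 | h1
      · left; rw [← h1]; simpa using hr0
      · right
        have := Real.sin_pos_of_pos_of_lt_pi h0 h
        positivity
  have hzd : ∀ t, HasDerivAt z w t := by
    intro t
    have := ((Complex.ofRealCLM.hasDerivAt (x := t)).mul_const w).const_add (r : ℂ)
    exact this.congr_deriv (by simp)
  have hlog : ∀ t ∈ Set.Icc (0 : ℝ) 1, HasDerivAt (fun t => Complex.log (z t)) (w / z t) t :=
    fun t ht => (hzd t).clog_real (hslit t ht)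
  have hlogre : ∀ t ∈ Set.Icc (0 : ℝ) 1,
      HasDerivAt (fun t => (Complex.log (z t)).re) (w / z t).re t := fun t ht =>
    (Complex.reCLM.hasFDerivAt.comp_hasDerivAt t (hlog t ht))
  have hlogim : ∀ t ∈ Set.Icc (0 : ℝ) 1,
      HasDerivAt (fun t => (Complex.log (z t)).im) (w / z t).im t := fun t ht =>
    (Complex.imCLM.hasFDerivAt.comp_hasDerivAt t (hlog t ht))
  have hlogc : ∀ t ∈ Set.Icc (0 : ℝ) 1, ContDiffAt ℝ 1 (fun t => Complex.log (z t)) t := by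
    intro t ht
    have h1 : ContDiffAt ℝ 1 z t := by
      have : z = fun t => (r : ℂ) + Complex.ofRealCLM t * w := rfl
      rw [this]; fun_prop
    exact ((Complex.contDiffAt_log (hslit t ht)).restrict_scalars ℝ).comp t h1
  -- The logarithm's real part is the log radius, spread equally over the eigenvalues; its imaginary
  -- part is the angle. If `θ = 0` then `p = 0`, so division by zero does no harm.
  let L : ℝ → Fin n → ℝ := fun t i =>
    4 / n * ((Complex.log (z t)).re - Real.log r) + (Complex.log (z t)).im / θ * p i
  let L' : ℝ → Fin n → ℝ := fun t i => 4 / n * (w / z t).re + (w / z t).im / θ * p i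
  have hz0 : z 0 = r := by simp [z]
  have hz1 : z 1 = s * Complex.exp (θ * Complex.I) := by simp [z, w]
  have hL0 : a = Fiber.ofFrame g hF (L 0) := by
    refine Fiber.ext ?_
    have : L 0 = 0 := by
      ext i
      simp only [L, hz0]
      rw [← Complex.ofReal_log hr0.le]
      simp
    rw [this, ha, Fiber.ofFrame]
    simp [Fiber.mat]
  have hlogz1 : Complex.log (z 1) = Real.log s + θ * Complex.I := by
    rw [hz1, Complex.log_ofReal_mul hs0 (Complex.exp_ne_zero _), Complex.log_exp]
    · simpa using by linarith [Real.pi_pos]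
    · simpa using h.le
  have hL1 : b = Fiber.ofFrame g hF (L 1) := by
    refine Fiber.ext ?_
    have : L 1 = l := by
      ext i
      simp only [L, hlogz1]
      have e1 : θ / θ * p i = p i := by
        rcases eq_or_ne θ 0 with h0 | h0
        · rw [h0] at hp2
          have : ∑ i, p i ^ 2 = 0 := by rw [hp2]; simp
          rw [Finset.sum_eq_zero_iff_of_nonneg fun i _ => sq_nonneg _] at this
          rw [pow_eq_zero_iff two_ne_zero |>.1 (this i (Finset.mem_univ i)), mul_zero]
        · rw [div_self h0, one_mul]
      simp only [Complex.add_re, Complex.ofReal_re, Complex.mul_re, Complex.I_re, mul_zero,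
        Complex.ofReal_im, Complex.I_im, mul_one, sub_self, add_zero, Complex.add_im,
        Complex.mul_im, zero_add]
      rw [e1, hsr]
      simp only [p]
      field_simp
      ring
    rw [this, hb]
    rfl
  have hrad : ∀ t ∈ Set.Icc (0 : ℝ) 1,
      fourthRootDet g (Fiber.ofFrame g hF (L t)).mat = ‖z t‖ := by
    intro t ht
    have hz : z t ≠ 0 := Complex.slitPlane_ne_zero (hslit t ht)
    rw [fourthRootDet_eq_mul_exp hg a (Fiber.ofFrame g hF (L t)) hF ha rfl, ← hr]
    have : (∑ i, L t i) / 4 = Real.log ‖z t‖ - Real.log r := by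
      simp only [L, Finset.sum_add_distrib, Finset.sum_const, Finset.card_univ,
        Fintype.card_fin, nsmul_eq_mul, ← Finset.mul_sum, hp0, Complex.log_re]
      field_simp
      ring
    rw [this, Real.exp_sub, Real.exp_log hr0, Real.exp_log (norm_pos_iff.2 hz),
      mul_div_cancel₀ _ hr0.ne']
  have hw : ‖w‖ = √(r ^ 2 + s ^ 2 - 2 * r * s * Real.cos θ) := by
    rw [← Real.sqrt_sq (norm_nonneg w)]
    congr 1
    rw [← Complex.normSq_eq_norm_sq, Complex.normSq_apply]
    have e1 : w.re = s * Real.cos θ - r := by simp [w, Complex.exp_ofReal_mul_I_re]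
    have e2 : w.im = s * Real.sin θ := by simp [w, Complex.exp_ofReal_mul_I_im]
    rw [e1, e2]
    linear_combination s ^ 2 * Real.sin_sq_add_cos_sq θ
  rw [← hw]
  refine dist_le_of_diagonal_arc hg hF (l := L) (l' := L') ?_ ?_ hL0 hL1
    (mul_nonneg (coneScale_pos hn).le (norm_nonneg _)) ?_
  · intro i t ht
    refine ContDiffAt.contDiffWithinAt ?_
    have h1 : ContDiffAt ℝ 1 (fun t => (Complex.log (z t)).re) t :=
      Complex.reCLM.contDiff.contDiffAt.comp t (hlogc t ht)
    have h2 : ContDiffAt ℝ 1 (fun t => (Complex.log (z t)).im) t :=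
      Complex.imCLM.contDiff.contDiffAt.comp t (hlogc t ht)
    exact (contDiffAt_const.mul (h1.sub contDiffAt_const)).add
      ((h2.div_const θ).mul contDiffAt_const)
  · intro t ht i
    refine HasDerivAt.hasDerivWithinAt ?_
    exact (((hlogre t ht).sub_const _).const_mul _).add
      (((hlogim t ht).div_const θ).mul_const (p i))
  · intro t ht
    have hz : z t ≠ 0 := Complex.slitPlane_ne_zero (hslit t ht)
    rw [hrad t ht]
    set x := (w / z t).re with hx
    set y := (w / z t).im with hy
    -- Radial and angular parts are orthogonal because `∑ p = 0`; equality may fail only when `θ =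
    -- 0`.
    have e1 : ∑ i, L' t i ^ 2 ≤ 16 / n * (x ^ 2 + y ^ 2) := by
      have : ∑ i, L' t i ^ 2 = n * (4 / n * x) ^ 2 + 2 * (4 / n * x) * (y / θ) * ∑ i, p i +
          (y / θ) ^ 2 * ∑ i, p i ^ 2 := by
        simp only [L', Finset.mul_sum]
        rw [show (n : ℝ) * (4 / n * x) ^ 2 = ∑ _i : Fin n, (4 / n * x) ^ 2 by simp,
          ← Finset.sum_add_distrib, ← Finset.sum_add_distrib]
        exact Finset.sum_congr rfl fun i _ => by ring
      rw [this, hp0, hp2]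
      have e2 : (y / θ) ^ 2 * θ ^ 2 ≤ y ^ 2 := by
        rcases eq_or_ne θ 0 with h0 | h0
        · rw [h0]; simpa using sq_nonneg y
        · rw [← mul_pow, div_mul_cancel₀ _ h0]
      have e3 := mul_le_mul_of_nonneg_left e2 (by positivity : (0 : ℝ) ≤ 16 / n)
      have e4 : (n : ℝ) * (4 / n * x) ^ 2 = 16 / n * x ^ 2 := by field_simp; ring
      rw [e4]
      linarith
    have e5 : (x ^ 2 + y ^ 2) * ‖z t‖ ^ 2 = ‖w‖ ^ 2 := by
      have : x ^ 2 + y ^ 2 = ‖w / z t‖ ^ 2 := by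
        rw [← Complex.normSq_eq_norm_sq, Complex.normSq_apply]; ring
      rw [this, ← mul_pow, norm_div, div_mul_cancel₀ _ (norm_ne_zero_iff.2 hz)]
    rw [mul_pow, coneScale_sq, ← e5, ← mul_assoc]
    exact mul_le_mul_of_nonneg_right e1 (sq_nonneg _)

/-- Equal radii force `∑ l = 0`, so the linear interpolation of exponents is an arc of constant
radius. -/
theorem dist_le_of_fourthRootDet_eq (hn : 1 ≤ n) (hg : g.PosDef) (a b : Fiber g)
    (h : fourthRootDet g a.mat = fourthRootDet g b.mat) :
    dist a b ≤ coneScale n * fourthRootDet g a.mat * ang a b := by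
  obtain ⟨F, l, hF, ha, hb⟩ := a.exists_frame b
  have hr0 := fourthRootDet_pos hg a
  have hl0 : ∑ i, l i = 0 := by
    have := fourthRootDet_eq_mul_exp hg a b hF ha hb
    rw [← h, left_eq_mul₀ hr0.ne', Real.exp_eq_one_iff] at this
    linarith
  refine dist_le_of_diagonal_arc hg hF (l := fun t i => t * l i) (l' := fun _ i => l i)
    (fun i => (contDiff_id.mul contDiff_const).contDiffOn)
    (fun t _ i => by simpa using ((hasDerivAt_id t).mul_const (l i)).hasDerivWithinAt)
    (Fiber.ext ?_) (Fiber.ext ?_)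
    (mul_nonneg (mul_nonneg (coneScale_pos hn).le hr0.le) (ang_nonneg a b)) fun t _ => ?_
  · rw [ha]; simp [Fiber.ofFrame, Fiber.mat]
  · rw [hb]; simp [Fiber.ofFrame, Fiber.mat]
  · rw [fourthRootDet_eq_mul_exp hg a (Fiber.ofFrame g hF fun i => t * l i) hF ha rfl,
      ← Finset.mul_sum, hl0, mul_zero, zero_div, Real.exp_zero, mul_one, mul_pow, mul_pow,
      mul_right_comm, ang_sq_eq hn, norm_chart_sq hn ha hb, hl0]
    simp

theorem dist_dilate_le (hn : 1 ≤ n) (hg : g.PosDef) (a : Fiber g) {s : ℝ} (hs : 0 < s) :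
    dist a (a.dilate s hs) ≤ coneScale n * |s - 1| * fourthRootDet g a.mat := by
  have hn' : (n : ℝ) ≠ 0 := by exact_mod_cast (by omega : n ≠ 0)
  have h := dist_scale_le hn a 1 (s ^ (4 / (n : ℝ))) one_pos (Real.rpow_pos_of_pos hs _)
  have e1 : a.scale 1 one_pos = a := Fiber.ext (one_smul _ _)
  have e2 : (s ^ (4 / (n : ℝ))) ^ ((n : ℝ) / 4) = s := by
    rw [← Real.rpow_mul hs.le]
    have : 4 / (n : ℝ) * (n / 4) = 1 := by field_simp
    rw [this, Real.rpow_one]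
  rw [e1, e2, Real.one_rpow, ← fourthRootDet_sq hg, ← coneScale_sq, ← mul_pow,
    Real.sqrt_sq (mul_nonneg (coneScale_pos hn).le (fourthRootDet_pos hg a).le)] at h
  calc _ ≤ _ := h
    _ = _ := by ring

theorem dist_le_add (hn : 1 ≤ n) (hg : g.PosDef) (a b : Fiber g) :
    dist a b ≤ coneScale n * (fourthRootDet g a.mat + fourthRootDet g b.mat) := by
  set r := fourthRootDet g a.mat with hr
  set s := fourthRootDet g b.mat with hs
  have hr0 : 0 < r := fourthRootDet_pos hg a
  have hs0 : 0 < s := fourthRootDet_pos hg b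
  have hK := coneScale_pos hn
  -- Shrink both points to radius `ε` and join them there at cost proportional to `ε`; then let `ε`
  -- tend to zero.
  have key : ∀ ε > 0, ε ≤ r → ε ≤ s →
      dist a b ≤ coneScale n * ((r - ε) + ε * ang a b + (s - ε)) := by
    intro ε hε h1 h2
    have d1 := dist_dilate_le hn hg a (div_pos hε hr0)
    have d2 := dist_dilate_le hn hg b (div_pos hε hs0)
    have e1 : fourthRootDet g (a.dilate _ (div_pos hε hr0)).mat = ε := by
      rw [fourthRootDet_dilate hn hg, ← hr, div_mul_cancel₀ _ hr0.ne']
    have e2 : fourthRootDet g (b.dilate _ (div_pos hε hs0)).mat = ε := by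
      rw [fourthRootDet_dilate hn hg, ← hs, div_mul_cancel₀ _ hs0.ne']
    have d3 := dist_le_of_fourthRootDet_eq hn hg _ _ (e1.trans e2.symm)
    rw [e1, Fiber.dilate, Fiber.dilate, ang_scale_left hn, ang_scale_right hn] at d3
    have q1 : |ε / r - 1| * r = r - ε := by
      rw [abs_sub_comm, abs_of_nonneg (sub_nonneg.2 ((div_le_one hr0).2 h1)), sub_mul,
        div_mul_cancel₀ _ hr0.ne', one_mul]
    have q2 : |ε / s - 1| * s = s - ε := by
      rw [abs_sub_comm, abs_of_nonneg (sub_nonneg.2 ((div_le_one hs0).2 h2)), sub_mul,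
        div_mul_cancel₀ _ hs0.ne', one_mul]
    rw [mul_assoc, ← hr, q1] at d1
    rw [mul_assoc, ← hs, q2, dist_comm] at d2
    have t1 := dist_triangle a (a.dilate _ (div_pos hε hr0)) b
    have t2 := dist_triangle (a.dilate _ (div_pos hε hr0)) (b.dilate _ (div_pos hε hs0)) b
    simp only [Fiber.dilate] at *
    linarith
  have hlim : Tendsto (fun ε : ℝ => coneScale n * ((r - ε) + ε * ang a b + (s - ε))) (𝓝[>] 0)
      (𝓝 (coneScale n * (r + s))) := by
    have : Continuous fun ε : ℝ => coneScale n * ((r - ε) + ε * ang a b + (s - ε)) := by fun_prop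
    have := this.tendsto 0
    simp only [sub_zero, zero_mul, add_zero] at this
    exact this.mono_left nhdsWithin_le_nhds
  refine ge_of_tendsto hlim ?_
  filter_upwards [Ioc_mem_nhdsGT (lt_min hr0 hs0)] with ε hε
  exact key ε hε.1 (hε.2.trans (min_le_left _ _)) (hε.2.trans (min_le_right _ _))

/-- The distance of two points of the cone with radii `r`, `s` and angle `θ`. -/
noncomputable def coneDist (r s θ : ℝ) : ℝ := √(r ^ 2 + s ^ 2 - 2 * r * s * coneCos θ)

theorem dist_le_coneDist (hn : 1 ≤ n) (hg : g.PosDef) (a b : Fiber g) :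
    dist a b ≤ coneScale n *
      coneDist (fourthRootDet g a.mat) (fourthRootDet g b.mat) (ang a b) := by
  rcases lt_or_ge (ang a b) Real.pi with h | h
  · rw [coneDist, coneCos_of_le h.le]
    exact dist_le_of_ang_lt_pi hn hg a b h
  · refine (dist_le_add hn hg a b).trans_eq ?_
    have := fourthRootDet_pos hg a
    have := fourthRootDet_pos hg b
    rw [coneDist, coneCos_of_ge h]
    congr 1
    symm
    rw [Real.sqrt_eq_iff_eq_sq] <;> nlinarith

end UpperBound

/-! ### Lower bound: cone distance grows no faster than length -/

section LowerBound

variable {n : ℕ} {g : Matrix (Fin n) (Fin n) ℝ}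

theorem coneDist_arg_nonneg (r s θ : ℝ) : 0 ≤ r ^ 2 + s ^ 2 - 2 * r * s * coneCos θ := by
  have h1 : coneCos θ ^ 2 ≤ 1 := by
    rw [sq_le_one_iff_abs_le_one]; exact Real.abs_cos_le_one _
  nlinarith [sq_nonneg (r - s * coneCos θ), sq_nonneg s]

theorem coneDist_sq (r s θ : ℝ) :
    coneDist r s θ ^ 2 = r ^ 2 + s ^ 2 - 2 * r * s * coneCos θ :=
  Real.sq_sqrt (coneDist_arg_nonneg r s θ)

theorem coneDist_eq_norm (r s θ : ℝ) : coneDist r s θ =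
    ‖(r : ℂ) - s * Complex.exp ((min Real.pi θ : ℝ) * Complex.I)‖ := by
  rw [coneDist, ← Real.sqrt_sq (norm_nonneg ((r : ℂ) - _)), ← Complex.normSq_eq_norm_sq,
    Complex.normSq_apply, coneCos]
  congr 1
  generalize min Real.pi θ = x
  have e1 : ((r : ℂ) - s * Complex.exp (x * Complex.I)).re = r - s * Real.cos x := by
    simp [Complex.exp_ofReal_mul_I_re]
  have e2 : ((r : ℂ) - s * Complex.exp (x * Complex.I)).im = -(s * Real.sin x) := by
    simp [Complex.exp_ofReal_mul_I_im]
  rw [e1, e2]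
  linear_combination -s ^ 2 * Real.sin_sq_add_cos_sq x

/-- Reverse triangle inequality in the plane, followed by `1 - x²/2 ≤ cos x`; the cutoff at `π` does
not increase angle differences. -/
theorem coneDist_sub_sq_le (r₀ : ℝ) {r s : ℝ} (hr : 0 ≤ r) (hs : 0 ≤ s) (θ θ' : ℝ) :
    (coneDist r₀ s θ' - coneDist r₀ r θ) ^ 2 ≤ (r - s) ^ 2 + r * s * (θ - θ') ^ 2 := by
  have hrs := mul_nonneg hr hs
  rw [coneDist_eq_norm, coneDist_eq_norm]
  set x := min Real.pi θ with hx
  set y := min Real.pi θ' with hy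
  have h1 : (x - y) ^ 2 ≤ (θ - θ') ^ 2 := by
    rw [sq_le_sq, hx, hy, min_comm, min_comm Real.pi]
    exact abs_inf_sub_inf_le_abs _ _ _
  have h2 := abs_norm_sub_norm_le ((r₀ : ℂ) - s * Complex.exp (y * Complex.I))
    ((r₀ : ℂ) - r * Complex.exp (x * Complex.I))
  rw [sub_sub_sub_cancel_left] at h2
  have h3 : ‖(r : ℂ) * Complex.exp (x * Complex.I) - s * Complex.exp (y * Complex.I)‖ ^ 2 =
      r ^ 2 + s ^ 2 - 2 * r * s * Real.cos (x - y) := by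
    rw [← Complex.normSq_eq_norm_sq, Complex.normSq_apply]
    have e1 : ((r : ℂ) * Complex.exp (x * Complex.I) - s * Complex.exp (y * Complex.I)).re =
        r * Real.cos x - s * Real.cos y := by simp [Complex.exp_ofReal_mul_I_re]
    have e2 : ((r : ℂ) * Complex.exp (x * Complex.I) - s * Complex.exp (y * Complex.I)).im =
        r * Real.sin x - s * Real.sin y := by simp [Complex.exp_ofReal_mul_I_im]
    rw [e1, e2, Real.cos_sub]
    linear_combination r ^ 2 * Real.sin_sq_add_cos_sq x + s ^ 2 * Real.sin_sq_add_cos_sq y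
  have h4 := pow_le_pow_left₀ (abs_nonneg _) h2 2
  rw [sq_abs, h3] at h4
  have h5 := mul_le_mul_of_nonneg_left (Real.one_sub_sq_div_two_le_cos (x := x - y)) hrs
  have h6 := mul_le_mul_of_nonneg_left h1 hrs
  nlinarith

theorem trace_inv_mul_add {A B : Matrix (Fin n) (Fin n) ℝ} (hA : IsUnit A) (hB : IsUnit B) :
    (A⁻¹ * B).trace + (B⁻¹ * A).trace - 2 * n =
      (A⁻¹ * (B - A) * (B⁻¹ * (B - A))).trace := by
  have h1 : A⁻¹ * A = 1 := nonsing_inv_mul _ ((isUnit_iff_isUnit_det _).1 hA)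
  have h2 : B⁻¹ * B = 1 := nonsing_inv_mul _ ((isUnit_iff_isUnit_det _).1 hB)
  have h3 : B * B⁻¹ = 1 := mul_nonsing_inv _ ((isUnit_iff_isUnit_det _).1 hB)
  have h4 : A⁻¹ * B * (B⁻¹ * A) = 1 := by
    rw [Matrix.mul_assoc, ← Matrix.mul_assoc B, h3, Matrix.one_mul, h1]
  rw [Matrix.mul_sub, Matrix.mul_sub, h1, h2, Matrix.sub_mul, Matrix.mul_sub, Matrix.mul_sub, h4]
  simp only [Matrix.mul_one, Matrix.one_mul, trace_sub, trace_one, Fintype.card_fin]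
  ring

/-- The distance in the cone from `p` to `a`. -/
noncomputable def fiberConeDist (p a : Fiber g) : ℝ :=
  coneScale n * coneDist (fourthRootDet g p.mat) (fourthRootDet g a.mat) (ang p a)

/-- The planar estimate combined with the trace bound in the chart at `p`. It involves no matrix
logarithm, so it can be differentiated along a curve directly. -/
theorem fiberConeDist_sub_sq_le (hn : 1 ≤ n) (hg : g.PosDef) (p a b : Fiber g) :
    (fiberConeDist p b - fiberConeDist p a) ^ 2 ≤
      16 / n * (fourthRootDet g a.mat - fourthRootDet g b.mat) ^ 2 +
      fourthRootDet g a.mat * fourthRootDet g b.mat *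
        ((a.mat⁻¹ * (b.mat - a.mat) * (b.mat⁻¹ * (b.mat - a.mat))).trace -
        16 / n * (Real.log (fourthRootDet g a.mat) - Real.log (fourthRootDet g b.mat)) ^ 2) := by
  have hn' : (0 : ℝ) < n := by exact_mod_cast hn
  have h1 := coneDist_sub_sq_le (fourthRootDet g p.mat) (fourthRootDet_pos hg a).le
    (fourthRootDet_pos hg b).le (ang p a) (ang p b)
  have h2 := norm_chart_sub_sq_le_trace hn p a b
  rw [trace_inv_mul_add a.posDef.isUnit b.posDef.isUnit, log_det_eq hg, log_det_eq hg] at h2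
  have h3 := abs_ang_sub_le p a b
  have h4 := pow_le_pow_left₀ (abs_nonneg _) h3 2
  rw [sq_abs, mul_pow, div_pow, Real.sq_sqrt hn'.le] at h4
  have hab := mul_nonneg (fourthRootDet_pos hg a).le (fourthRootDet_pos hg b).le
  set ra := fourthRootDet g a.mat
  set rb := fourthRootDet g b.mat
  have h5 : 16 / n * (ang p a - ang p b) ^ 2 ≤ ‖chart p a - chart p b‖ ^ 2 := by
    calc _ ≤ 16 / n * (n / 4 ^ 2 * ‖chart p a - chart p b‖ ^ 2) :=
          mul_le_mul_of_nonneg_left h4 (by positivity)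
      _ = _ := by field_simp; norm_num
  rw [fiberConeDist, fiberConeDist, ← mul_sub, mul_pow, coneScale_sq]
  have h6 := mul_le_mul_of_nonneg_left h1 (by positivity : (0 : ℝ) ≤ 16 / n)
  have h7 := mul_le_mul_of_nonneg_left (h5.trans h2) hab
  have h8 : (4 * Real.log ra + Real.log g.det - (4 * Real.log rb + Real.log g.det)) ^ 2 / n =
      16 / n * (Real.log ra - Real.log rb) ^ 2 := by ring
  rw [h8] at h7
  linarith

variable {p q : Fiber g}

/-- The point of a `C¹` arc at time `t`. -/
noncomputable def C1Arc.point (c : C1Arc p q) (t : ℝ) : Fiber g :=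
  ⟨c.toFun (Set.projIcc 0 1 zero_le_one t), c.posDef _ (Set.projIcc 0 1 zero_le_one t).2⟩

theorem C1Arc.point_mat (c : C1Arc p q) {t : ℝ} (ht : t ∈ Set.Icc (0 : ℝ) 1) :
    (c.point t).mat = c.toFun t := by
  change c.toFun _ = _
  rw [Set.projIcc_of_mem _ ht]

theorem C1Arc.point_zero (c : C1Arc p q) : c.point 0 = p :=
  Fiber.ext (by rw [c.point_mat (by simp), c.source])

theorem C1Arc.point_one (c : C1Arc p q) : c.point 1 = q :=
  Fiber.ext (by rw [c.point_mat (by simp), c.target])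

theorem C1Arc.hasDerivWithinAt (c : C1Arc p q) {t : ℝ} (ht : t ∈ Set.Icc (0 : ℝ) 1)
    (i j : Fin n) : HasDerivWithinAt (fun s => c.toFun s i j) (velocity c.toFun t i j)
      (Set.Icc 0 1) t :=
  (((c.contDiffOn i j).differentiableOn one_ne_zero) _ ht).hasDerivWithinAt

theorem C1Arc.continuousOn_toFun (c : C1Arc p q) : ContinuousOn c.toFun (Set.Icc 0 1) :=
  continuousOn_pi.2 fun i => continuousOn_pi.2 fun j => (c.contDiffOn i j).continuousOn

theorem C1Arc.continuousOn_velocity (c : C1Arc p q) :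
    ContinuousOn (velocity c.toFun) (Set.Icc 0 1) :=
  continuousOn_pi.2 fun i => continuousOn_pi.2 fun j =>
    (c.contDiffOn i j).continuousOn_derivWithin (uniqueDiffOn_Icc zero_lt_one) le_rfl

theorem C1Arc.continuousOn_inv (c : C1Arc p q) :
    ContinuousOn (fun t => (c.toFun t)⁻¹) (Set.Icc 0 1) := by
  have : (fun t => (c.toFun t)⁻¹) = fun t => (c.toFun t).det⁻¹ • (c.toFun t).adjugate := by
    ext1 t; rw [Matrix.inv_def, Ring.inverse_eq_inv']
  rw [this]
  have h1 : ContinuousOn (fun t => (c.toFun t).det) (Set.Icc 0 1) :=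
    (Continuous.matrix_det continuous_id).comp_continuousOn c.continuousOn_toFun
  have h2 : ContinuousOn (fun t => (c.toFun t).adjugate) (Set.Icc 0 1) :=
    (Continuous.matrix_adjugate continuous_id).comp_continuousOn c.continuousOn_toFun
  exact (h1.inv₀ fun t ht => (c.posDef t ht).det_pos.ne').smul h2

theorem C1Arc.differentiableOn_relDet (c : C1Arc p q) :
    DifferentiableOn ℝ (fun t => relDet g (c.toFun t)) (Set.Icc 0 1) := by
  have : (fun t => relDet g (c.toFun t)) = fun t => g⁻¹.det * (c.toFun t).det := by
    ext1 t; rw [relDet, det_mul]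
  rw [this]
  simp only [det_apply]
  refine DifferentiableOn.const_mul (DifferentiableOn.fun_sum fun σ _ => ?_) _
  refine DifferentiableOn.const_smul ?_ _
  exact DifferentiableOn.fun_finsetProd fun i _ => (c.contDiffOn _ _).differentiableOn one_ne_zero

theorem C1Arc.relDet_pos (hg : g.PosDef) (c : C1Arc p q) {t : ℝ} (ht : t ∈ Set.Icc (0 : ℝ) 1) :
    0 < relDet g (c.toFun t) := by
  rw [← c.point_mat ht]; exact MetricFiber.relDet_pos hg _

theorem C1Arc.differentiableOn_fourthRootDet (hg : g.PosDef) (c : C1Arc p q) :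
    DifferentiableOn ℝ (fun t => fourthRootDet g (c.toFun t)) (Set.Icc 0 1) :=
  c.differentiableOn_relDet.rpow_const fun _ ht => Or.inl (c.relDet_pos hg ht).ne'

theorem C1Arc.continuousOn_riemNorm (c : C1Arc p q) :
    ContinuousOn (fun t => riemNorm g (c.toFun t) (velocity c.toFun t)) (Set.Icc 0 1) := by
  have h1 : ContinuousOn (fun t => (c.toFun t)⁻¹ * velocity c.toFun t) (Set.Icc 0 1) :=
    c.continuousOn_inv.mul c.continuousOn_velocity
  have h2 : ContinuousOn (fun t => trProd (c.toFun t) (velocity c.toFun t)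
      (velocity c.toFun t)) (Set.Icc 0 1) :=
    (Continuous.matrix_trace continuous_id).comp_continuousOn (h1.mul h1)
  exact (h2.mul c.differentiableOn_relDet.continuousOn.sqrt).sqrt

theorem C1Arc.fiberConeDist_sub_sq_le (hn : 1 ≤ n) (hg : g.PosDef) (c : C1Arc p q) (o : Fiber g)
    {t s : ℝ} (ht : t ∈ Set.Icc (0 : ℝ) 1) (hs : s ∈ Set.Icc (0 : ℝ) 1) :
    (fiberConeDist o (c.point s) - fiberConeDist o (c.point t)) ^ 2 ≤
      16 / n * (fourthRootDet g (c.toFun t) - fourthRootDet g (c.toFun s)) ^ 2 +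
      fourthRootDet g (c.toFun t) * fourthRootDet g (c.toFun s) *
        (((c.toFun t)⁻¹ * (c.toFun s - c.toFun t) *
          ((c.toFun s)⁻¹ * (c.toFun s - c.toFun t))).trace -
        16 / n * (Real.log (fourthRootDet g (c.toFun t)) -
          Real.log (fourthRootDet g (c.toFun s))) ^ 2) := by
  have := MetricFiber.fiberConeDist_sub_sq_le hn hg o (c.point t) (c.point s)
  rwa [c.point_mat ht, c.point_mat hs] at this

theorem C1Arc.fourthRootDet_pos (hg : g.PosDef) (c : C1Arc p q) {t : ℝ}
    (ht : t ∈ Set.Icc (0 : ℝ) 1) : 0 < fourthRootDet g (c.toFun t) :=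
  Real.rpow_pos_of_pos (c.relDet_pos hg ht) _

theorem C1Arc.continuousOn_fiberConeDist (hn : 1 ≤ n) (hg : g.PosDef) (c : C1Arc p q)
    (o : Fiber g) : ContinuousOn (fun t => fiberConeDist o (c.point t)) (Set.Icc 0 1) := by
  intro t ht
  have h0 := c.fourthRootDet_pos hg ht
  have h1 : ContinuousWithinAt (fun s => fourthRootDet g (c.toFun s)) (Set.Icc 0 1) t :=
    (c.differentiableOn_fourthRootDet hg).continuousOn t ht
  have h2 : ContinuousWithinAt (fun s => Real.log (fourthRootDet g (c.toFun s)))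
      (Set.Icc 0 1) t := h1.log h0.ne'
  have h3 : ContinuousWithinAt (fun s => c.toFun s - c.toFun t) (Set.Icc 0 1) t :=
    (c.continuousOn_toFun t ht).sub continuousWithinAt_const
  have h4 : ContinuousWithinAt (fun s => ((c.toFun t)⁻¹ * (c.toFun s - c.toFun t) *
          ((c.toFun s)⁻¹ * (c.toFun s - c.toFun t))).trace) (Set.Icc 0 1) t :=
    (Continuous.matrix_trace continuous_id).continuousAt.comp_continuousWithinAt
      ((continuousWithinAt_const.mul h3).mul ((c.continuousOn_inv t ht).mul h3))
  have h5 := ((((continuousWithinAt_const (b := fourthRootDet g (c.toFun t))).sub h1).pow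
    2).const_mul (16 / n : ℝ)).add ((h1.const_mul (fourthRootDet g (c.toFun t))).mul
    (h4.sub ((((continuousWithinAt_const (b := Real.log (fourthRootDet g (c.toFun t)))).sub
      h2).pow 2).const_mul (16 / n : ℝ))))
  have h6 := h5.tendsto
  simp only [Pi.add_apply, Pi.mul_apply, Pi.sub_apply, Pi.pow_apply] at h6
  simp only [sub_self, trace_zero, ne_eq, OfNat.ofNat_ne_zero,
    not_false_eq_true, zero_pow, mul_zero, add_zero] at h6
  have h7 : Tendsto (fun s => (fiberConeDist o (c.point s) - fiberConeDist o (c.point t)) ^ 2)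
      (𝓝[Set.Icc 0 1] t) (𝓝 0) :=
    tendsto_of_tendsto_of_tendsto_of_le_of_le' tendsto_const_nhds h6
      (Eventually.of_forall fun _ => sq_nonneg _)
      (eventually_mem_nhdsWithin.mono fun s hs => c.fiberConeDist_sub_sq_le hn hg o ht hs)
  have h8 := h7.sqrt
  simp only [Real.sqrt_sq_eq_abs, Real.sqrt_zero] at h8
  have h9 := (tendsto_zero_iff_abs_tendsto_zero _).2 h8
  exact tendsto_sub_nhds_zero_iff.1 h9

theorem C1Arc.eventually_slope_lt (hn : 1 ≤ n) (hg : g.PosDef) (c : C1Arc p q) (o : Fiber g)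
    {t : ℝ} (ht : t ∈ Set.Ico (0 : ℝ) 1) {r : ℝ}
    (hr : riemNorm g (c.toFun t) (velocity c.toFun t) < r) :
    ∀ᶠ s in 𝓝[>] t, slope (fun t => fiberConeDist o (c.point t)) t s < r := by
  have htI : t ∈ Set.Icc (0 : ℝ) 1 := ⟨ht.1, ht.2.le⟩
  have h0 := c.fourthRootDet_pos hg htI
  have hfil : 𝓝[>] t ≤ 𝓝[Set.Icc 0 1 \ {t}] t := by
    rw [← nhdsWithin_Ioo_eq_nhdsGT ht.2]
    exact nhdsWithin_mono _ fun s hs => ⟨⟨ht.1.trans hs.1.le, hs.2.le⟩, hs.1.ne'⟩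
  have hfil' : 𝓝[>] t ≤ 𝓝[Set.Icc 0 1] t := hfil.trans (nhdsWithin_mono _ Set.sdiff_subset)
  have d1 := (((c.differentiableOn_fourthRootDet hg) t htI).hasDerivWithinAt)
  set ρ' := derivWithin (fun t => fourthRootDet g (c.toFun t)) (Set.Icc 0 1) t
  have d2 := d1.log h0.ne'
  have l1 := (hasDerivWithinAt_iff_tendsto_slope.1 d1).mono_left hfil
  have l2 := (hasDerivWithinAt_iff_tendsto_slope.1 d2).mono_left hfil
  have l3 : Tendsto (fun s => (s - t)⁻¹ • (c.toFun s - c.toFun t)) (𝓝[>] t)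
      (𝓝 (velocity c.toFun t)) := by
    refine tendsto_pi_nhds.2 fun i => tendsto_pi_nhds.2 fun j => ?_
    exact (hasDerivWithinAt_iff_tendsto_slope.1 (c.hasDerivWithinAt htI i j)).mono_left hfil
  have l4 : Tendsto (fun s => (c.toFun s)⁻¹) (𝓝[>] t) (𝓝 (c.toFun t)⁻¹) :=
    (c.continuousOn_inv t htI).tendsto.mono_left hfil'
  have l5 : Tendsto (fun s => fourthRootDet g (c.toFun s)) (𝓝[>] t)
      (𝓝 (fourthRootDet g (c.toFun t))) := d1.continuousWithinAt.tendsto.mono_left hfil'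
  have l6 := ((Continuous.matrix_trace continuous_id).tendsto _).comp
    ((l3.const_mul (c.toFun t)⁻¹).mul (l4.mul l3))
  have l7 := ((l1.pow 2).const_mul (16 / n : ℝ)).add
    ((l5.const_mul (fourthRootDet g (c.toFun t))).mul (l6.sub ((l2.pow 2).const_mul (16 / n : ℝ))))
  -- In the limit the radial term cancels against the logarithmic correction, leaving exactly the
  -- squared Riemannian speed.
  have hval : 16 / (n : ℝ) * ρ' ^ 2 + fourthRootDet g (c.toFun t) * fourthRootDet g (c.toFun t) *
      (((c.toFun t)⁻¹ * velocity c.toFun t * ((c.toFun t)⁻¹ * velocity c.toFun t)).trace -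
        16 / n * (ρ' / fourthRootDet g (c.toFun t)) ^ 2) =
      riemInner g (c.toFun t) (velocity c.toFun t) (velocity c.toFun t) := by
    have h1 := fourthRootDet_sq hg (c.point t)
    rw [c.point_mat htI] at h1
    rw [riemInner, trProd, ← h1]
    field_simp
    ring
  simp only [id] at l7
  rw [hval] at l7
  have l8 := l7.sqrt
  filter_upwards [l8.eventually_lt_const hr, hfil' self_mem_nhdsWithin, self_mem_nhdsWithin]
    with s hs hsI hst
  refine lt_of_le_of_lt (Real.le_sqrt_of_sq_le ?_) hs
  have hst' : s - t ≠ 0 := sub_ne_zero.2 (ne_of_gt hst)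
  have key := c.fiberConeDist_sub_sq_le hn hg o htI hsI
  have key2 := mul_le_mul_of_nonneg_left key (sq_nonneg (s - t)⁻¹)
  refine (le_of_eq ?_).trans (key2.trans_eq ?_)
  · rw [slope_def_field]; field_simp
  · simp only [Function.comp, slope_def_field, Matrix.mul_smul, Matrix.smul_mul, trace_smul,
      smul_eq_mul]
    ring

theorem C1Arc.fiberConeDist_le (hn : 1 ≤ n) (hg : g.PosDef) (c : C1Arc p q) (o : Fiber g) :
    fiberConeDist o q ≤ fiberConeDist o p + c.length := by
  -- Extending the speed continuously to the line makes its integral differentiable at the endpoints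
  -- too.
  set v : ℝ → ℝ := Set.IccExtend zero_le_one
    ((Set.Icc (0 : ℝ) 1).domRestrict fun t => riemNorm g (c.toFun t) (velocity c.toFun t)) with hv
  have hvc : Continuous v :=
    (continuousOn_iff_continuous_domRestrict.1 (c.continuousOn_riemNorm)).Icc_extend'
  have hveq : ∀ t ∈ Set.Icc (0 : ℝ) 1, v t = riemNorm g (c.toFun t) (velocity c.toFun t) :=
    fun t ht => by rw [hv, Set.IccExtend_of_mem _ _ ht]; rfl
  have hB : ∀ x, HasDerivAt (fun t => fiberConeDist o p + ∫ s in (0 : ℝ)..t, v s) (v x) x :=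
    fun x => (intervalIntegral.integral_hasDerivAt_right (hvc.intervalIntegrable _ _)
      (hvc.stronglyMeasurableAtFilter _ _) hvc.continuousAt).const_add _
  have := image_le_of_liminf_slope_right_le_deriv_boundary
    (c.continuousOn_fiberConeDist hn hg o) (B := fun t => fiberConeDist o p +
      ∫ s in (0 : ℝ)..t, v s) (B' := v) (by simp [c.point_zero])
    (fun x _ => (hB x).continuousAt.continuousWithinAt)
    (fun x _ => (hB x).hasDerivWithinAt)
    (fun x hx r hr => (c.eventually_slope_lt hn hg o hx
      (by rwa [← hveq x ⟨hx.1, hx.2.le⟩])).frequently) (Set.right_mem_Icc.2 zero_le_one)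
  rw [c.point_one] at this
  refine this.trans_eq ?_
  congr 1
  refine intervalIntegral.integral_congr fun t ht => ?_
  rw [Set.uIcc_of_le zero_le_one] at ht
  exact hveq t ht

theorem PiecewiseC1Path.fiberConeDist_le (hn : 1 ≤ n) (hg : g.PosDef) (o : Fiber g)
    (σ : PiecewiseC1Path p q) : fiberConeDist o q ≤ fiberConeDist o p + σ.length := by
  induction σ with
  | nil p => simp [PiecewiseC1Path.length]
  | cons c σ ih =>
    have := c.fiberConeDist_le hn hg o
    rw [PiecewiseC1Path.length]
    linarith

theorem coneDist_self (r : ℝ) : coneDist r r 0 = 0 := by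
  rw [coneDist, coneCos_of_le Real.pi_pos.le, Real.cos_zero, Real.sqrt_eq_zero']
  linarith

/-- For the lower bound, cone distance is measured from the starting point `a` of the path, where it
vanishes. -/
theorem dist_eq_fiberConeDist (hn : 1 ≤ n) (hg : g.PosDef) (a b : Fiber g) :
    dist a b = fiberConeDist a b := by
  refine le_antisymm (dist_le_coneDist hn hg a b) (le_ciInf fun σ => ?_)
  have := σ.fiberConeDist_le hn hg a
  rwa [fiberConeDist, fiberConeDist, ang_self, coneDist_self, mul_zero, zero_add] at this

theorem dist_sq_eq (hn : 1 ≤ n) (hg : g.PosDef) (a b : Fiber g) :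
    dist a b ^ 2 = 16 / n * (fourthRootDet g a.mat ^ 2 + fourthRootDet g b.mat ^ 2 -
      2 * fourthRootDet g a.mat * fourthRootDet g b.mat * coneCos (ang a b)) := by
  rw [dist_eq_fiberConeDist hn hg, fiberConeDist, mul_pow, coneDist_sq, coneScale_sq]

end LowerBound

/-! ### Barycenters in the completion and the critical angle -/

section Completion

variable {n : ℕ} {g : Matrix (Fin n) (Fin n) ℝ}

theorem dist_coe_sq (hn : 1 ≤ n) (hg : g.PosDef) (a b : Fiber g) :
    dist (a : CompletedFiber g) b ^ 2 = 16 / n * (fourthRootDet g a.mat ^ 2 +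
      fourthRootDet g b.mat ^ 2 -
      2 * fourthRootDet g a.mat * fourthRootDet g b.mat * coneCos (ang a b)) := by
  rw [UniformSpace.Completion.dist_eq, dist_sq_eq hn hg]

theorem fourthRootDet_scale (hn : 1 ≤ n) (hg : g.PosDef) (a : Fiber g) {s : ℝ} (hs : 0 < s) :
    fourthRootDet g (a.scale s hs).mat = s ^ ((n : ℝ) / 4) * fourthRootDet g a.mat := by
  have hn' : (n : ℝ) ≠ 0 := by exact_mod_cast (by omega : n ≠ 0)
  rw [← fourthRootDet_dilate hn hg a (Real.rpow_pos_of_pos hs _)]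
  have : (s ^ ((n : ℝ) / 4)) ^ (4 / (n : ℝ)) = s := by
    rw [← Real.rpow_mul hs.le]
    have : (n : ℝ) / 4 * (4 / n) = 1 := by field_simp
    rw [this, Real.rpow_one]
  simp only [Fiber.dilate, this]

theorem dist_zeroPoint_sq (hn : 1 ≤ n) (hg : g.PosDef) (a : Fiber g) :
    dist (a : CompletedFiber g) (zeroPoint hg) ^ 2 = 16 / n * fourthRootDet g a.mat ^ 2 := by
  have hn' : (0 : ℝ) < n := by exact_mod_cast hn
  have h1 := ((tendsto_const_nhds (x := (a : CompletedFiber g))).dist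
    (tendsto_zeroPoint hn hg)).pow 2
  refine tendsto_nhds_unique h1 ?_
  simp only [dist_coe_sq hn hg, fourthRootDet_scale hn hg, ang_scale_right hn]
  have h0 : Tendsto (fun k : ℕ => (1 / ((k : ℝ) + 1)) ^ ((n : ℝ) / 4)) atTop (𝓝 0) := by
    have := tendsto_one_div_add_atTop_nhds_zero_nat (𝕜 := ℝ)
    have h := this.rpow_const (p := (n : ℝ) / 4) (Or.inr (by positivity))
    rwa [Real.zero_rpow (by positivity)] at h
  have h2 := h0.mul_const (fourthRootDet g (Fiber.ofPosDef hg : Fiber g).mat)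
  rw [zero_mul] at h2
  have h3 := (((h2.pow 2).const_add (fourthRootDet g a.mat ^ 2)).sub
    ((h2.const_mul (2 * fourthRootDet g a.mat)).mul_const
      (coneCos (ang a (Fiber.ofPosDef hg : Fiber g))))).const_mul (16 / n : ℝ)
  simpa using h3

theorem straight_of_pos (hg : g.PosDef) (a : Fiber g) {s : ℝ} (hs : 0 < s) :
    straight hg a s = (a.dilate s hs : CompletedFiber g) := by
  rw [straight, dif_pos hs]; rfl

/-- At `s = 0` the angle term disappears, so one formula covers the vertex. -/
theorem dist_straight_sq (hn : 1 ≤ n) (hg : g.PosDef) (z a : Fiber g) {s : ℝ} (hs : 0 ≤ s) :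
    dist (z : CompletedFiber g) (straight hg a s) ^ 2 = 16 / n * (fourthRootDet g z.mat ^ 2 +
      (s * fourthRootDet g a.mat) ^ 2 -
      2 * fourthRootDet g z.mat * (s * fourthRootDet g a.mat) * coneCos (ang z a)) := by
  rcases hs.eq_or_lt with h | h
  · rw [← h, straight, dif_neg (lt_irrefl _), dist_zeroPoint_sq hn hg]
    simp
  · rw [straight_of_pos hg a h, dist_coe_sq hn hg, fourthRootDet_dilate hn hg, Fiber.dilate,
      ang_scale_right hn]

theorem IsBarycenter.of_fiber {p q m : CompletedFiber g} {t : ℝ}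
    (h : ∀ z : Fiber g, dist (z : CompletedFiber g) m ^ 2 ≤
      (1 - t) * dist (z : CompletedFiber g) p ^ 2 + t * dist (z : CompletedFiber g) q ^ 2 -
        t * (1 - t) * dist p q ^ 2) : IsBarycenter p q t m :=
  IsBarycenter.of_dense UniformSpace.Completion.denseRange_coe (by rintro _ ⟨z, rfl⟩; exact h z)

/-- Below the critical angle, the barycenters of two points of the fiber lie in the fiber. -/
theorem exists_isBarycenter_of_ang_lt (hn : 1 ≤ n) (hg : g.PosDef) (a b : Fiber g)
    (h : ang a b < Real.pi) {t : ℝ} (ht : t ∈ Set.Icc (0 : ℝ) 1) :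
    ∃ m : Fiber g, IsBarycenter (a : CompletedFiber g) b t m := by
  have hr := fourthRootDet_pos hg a
  have hs := fourthRootDet_pos hg b
  set r := fourthRootDet g a.mat with hra
  set s := fourthRootDet g b.mat with hsb
  have ht1 : 0 ≤ 1 - t := by linarith [ht.2]
  -- The candidate is the point of ratio `t` on the planar segment: the sum of vectors of lengths
  -- `(1 - t) r` and `t s` enclosing the angle `ang a b`.
  obtain ⟨τ, hτ, ρ, hρ, hρ2, hcos, hsin⟩ := exists_polar (mul_nonneg ht1 hr.le)
    (mul_nonneg ht.1 hs.le) (convex_Ioi (0 : ℝ) hr hs ht1 ht.1 (by ring)) (ang_nonneg a b) h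
  obtain ⟨m, v, hm, hma, hmb, hv⟩ := exists_chart_eq_smul hn hg a b τ hρ
  refine ⟨m, IsBarycenter.of_fiber fun z => ?_⟩
  have hκ : 0 ≤ √(n : ℝ) / 4 := by positivity
  have hnorm : ∀ x : EuclideanSpace ℝ (Fin n × Fin n),
      ‖(√(n : ℝ) / 4) • x‖ = √(n : ℝ) / 4 * ‖x‖ := fun x => by
    rw [norm_smul, Real.norm_of_nonneg hκ]
  have hv' : ‖(√(n : ℝ) / 4) • v‖ = ang a b := by rw [hnorm, hv]
  -- The chart at `m` is exact for distances from `m` and does not increase the others; this is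
  -- where nonpositive curvature enters.
  have hα : ‖(√(n : ℝ) / 4) • chart m z + τ • (√(n : ℝ) / 4) • v‖ ≤ ang z a := by
    rw [smul_comm τ, ← smul_add, hnorm, ang]
    refine mul_le_mul_of_nonneg_left ?_ hκ
    have := norm_chart_sub_le hn m z a
    rwa [hma, sub_neg_eq_add] at this
  have hβ : ‖(√(n : ℝ) / 4) • chart m z - (1 - τ) • (√(n : ℝ) / 4) • v‖ ≤ ang z b := by
    rw [smul_comm (1 - τ), ← smul_sub, hnorm, ang]
    refine mul_le_mul_of_nonneg_left ?_ hκ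
    have := norm_chart_sub_le hn m z b
    rwa [hmb] at this
  have key := add_coneCos_le hτ (hv' ▸ h) (mul_nonneg ht1 hr.le) (mul_nonneg ht.1 hs.le)
    (ρ := ρ) (by rw [hv']; exact hcos) (by rw [hv']; exact hsin) hα hβ
  have hw : ‖(√(n : ℝ) / 4) • chart m z‖ = ang z m := by rw [hnorm, ang_comm hn z m, ang]
  rw [hw] at key
  simp only [dist_coe_sq hn hg, hm, ← hra, ← hsb, coneCos_of_le h.le]
  have hu := fourthRootDet_pos hg z
  set u := fourthRootDet g z.mat
  have k2 := mul_le_mul_of_nonneg_left key (by positivity : 0 ≤ 16 / n * (2 * u))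
  linear_combination k2 + 16 / n * hρ2

/-- Beyond the critical angle, the barycenters run along the segments through `[0]`. -/
theorem isBarycenter_brokenSegment (hn : 1 ≤ n) (hg : g.PosDef) (a b : Fiber g)
    (h : Real.pi ≤ ang a b) {t : ℝ} (ht : t ∈ Set.Icc (0 : ℝ) 1) :
    IsBarycenter (a : CompletedFiber g) b t (brokenSegment hg a b t) := by
  refine IsBarycenter.of_fiber fun z => ?_
  have hr := fourthRootDet_pos hg a
  have hs := fourthRootDet_pos hg b
  have hu := fourthRootDet_pos hg z
  have hC : coneCos (ang z a) + coneCos (ang z b) ≤ 0 := by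
    refine coneCos_add_le_zero (ang_nonneg _ _) (h.trans ?_)
    rw [ang_comm hn z a]
    exact ang_triangle hn a z b
  have hb : breakTime a b = fourthRootDet g a.mat / (fourthRootDet g a.mat +
    fourthRootDet g b.mat) := rfl
  have ht1 : 0 ≤ 1 - t := by linarith [ht.2]
  unfold brokenSegment
  split_ifs with hle
  · have h1 : 0 ≤ 1 - t / breakTime a b := by
      have : 0 < breakTime a b := by rw [hb]; positivity
      rw [sub_nonneg, div_le_one this]; exact hle
    -- The signed radius along the broken segment is affine in `t`. Substituting it leaves only a
    -- nonnegative multiple of the sum in `hC`.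
    have e : (1 - t / breakTime a b) * fourthRootDet g a.mat =
        (1 - t) * fourthRootDet g a.mat - t * fourthRootDet g b.mat := by
      rw [hb]; field_simp; ring
    rw [dist_straight_sq hn hg z a h1, e]
    simp only [dist_coe_sq hn hg, coneCos_of_ge h]
    have k := mul_nonpos_of_nonneg_of_nonpos (mul_nonneg (mul_nonneg (by positivity :
      0 ≤ 16 / n * (2 * fourthRootDet g z.mat)) ht.1) hs.le) hC
    linear_combination k
  · have hlt : 0 < t - breakTime a b := sub_pos.2 (not_le.1 hle)
    have e0 : 1 - breakTime a b = fourthRootDet g b.mat / (fourthRootDet g a.mat +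
        fourthRootDet g b.mat) := by rw [hb]; field_simp; ring
    have h0 : 0 < 1 - breakTime a b := by rw [e0]; positivity
    have e : (t - breakTime a b) / (1 - breakTime a b) * fourthRootDet g b.mat =
        t * fourthRootDet g b.mat - (1 - t) * fourthRootDet g a.mat := by
      rw [e0, hb]; field_simp; ring
    rw [dist_straight_sq hn hg z b (div_nonneg hlt.le h0.le), e]
    simp only [dist_coe_sq hn hg, coneCos_of_ge h]
    have k := mul_nonpos_of_nonneg_of_nonpos (mul_nonneg (mul_nonneg (by positivity :
      0 ≤ 16 / n * (2 * fourthRootDet g z.mat)) ht1) hr.le) hC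
    linear_combination k

theorem exists_isBarycenter (hn : 1 ≤ n) (hg : g.PosDef) (p q : CompletedFiber g) {t : ℝ}
    (ht : t ∈ Set.Icc (0 : ℝ) 1) : ∃ m, IsBarycenter p q t m := by
  refine exists_isBarycenter_of_dense
    (S := Set.range ((↑) : Fiber g → CompletedFiber g))
    UniformSpace.Completion.denseRange_coe ht ?_ p q
  rintro _ ⟨a, rfl⟩ _ ⟨b, rfl⟩
  rcases lt_or_ge (ang a b) Real.pi with h | h
  · obtain ⟨m, hm⟩ := exists_isBarycenter_of_ang_lt hn hg a b h ht
    exact ⟨m, hm⟩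
  · exact ⟨_, isBarycenter_brokenSegment hn hg a b h ht⟩

/-- In a frame diagonalizing `a₀` and `b` together, the eigenvalues of `b` are the logarithmic
eigenvalues of `a₁` relative to `a₀`. -/
theorem trProd_traceless_eq (hn : 1 ≤ n) {a₀ a₁ : Fiber g} {b : Matrix (Fin n) (Fin n) ℝ}
    (hb : b.IsSymm) (h : a₁.mat = a₀.mat * NormedSpace.exp (a₀.mat⁻¹ * b)) :
    trProd a₀.mat (traceless a₀.mat b) (traceless a₀.mat b) = ‖chart a₀ a₁‖ ^ 2 := by
  have hn' : (n : ℝ) ≠ 0 := by exact_mod_cast (by omega : n ≠ 0)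
  obtain ⟨F, l, hF, e0, e1⟩ := exists_simultaneous_diagonalization a₀.posDef
    (b := b) (by simpa [IsHermitian] using hb.eq)
  have hFt := isUnit_transpose' hF
  have h1 : (Fᵀ)⁻¹ * Fᵀ = 1 := nonsing_inv_mul _ ((isUnit_iff_isUnit_det _).1 hFt)
  have h2 : Fᵀ * (Fᵀ)⁻¹ = 1 := mul_nonsing_inv _ ((isUnit_iff_isUnit_det _).1 hFt)
  have e0' : a₀.mat = F * diagonal (1 : Fin n → ℝ) * Fᵀ := by
    rw [e0, diagonal_one', Matrix.mul_one]
  have hinv : a₀.mat⁻¹ * b = (Fᵀ)⁻¹ * diagonal l * Fᵀ := by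
    have := inv_mul_conj_diagonal hF (d := 1) (e := l) fun _ => one_ne_zero
    rwa [mul_one, ← e0', ← e1] at this
  have hexp : a₁.mat = F * diagonal (fun i => Real.exp (l i)) * Fᵀ := by
    have h3 := Matrix.exp_conj (Fᵀ)⁻¹ (diagonal l) (isUnit_inv' hFt)
    rw [Matrix.nonsing_inv_nonsing_inv _ ((isUnit_iff_isUnit_det _).1 hFt),
      Matrix.exp_diagonal] at h3
    have h4 : (NormedSpace.exp l : Fin n → ℝ) = fun i => Real.exp (l i) := by
      ext i
      rw [Pi.coe_exp, Real.exp_eq_exp_ℝ]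
    rw [h, hinv, h3, h4, e0]
    calc _ = F * (Fᵀ * (Fᵀ)⁻¹) * diagonal (fun i => Real.exp (l i)) * Fᵀ := by
          simp only [Matrix.mul_assoc]
      _ = _ := by rw [h2, Matrix.mul_one]
  have htr : (a₀.mat⁻¹ * b).trace = ∑ i, l i := by
    rw [hinv, trace_mul_comm, ← Matrix.mul_assoc, h2, Matrix.one_mul, trace_diagonal]
  have htl : traceless a₀.mat b =
      F * diagonal ((fun i => l i - (∑ j, l j) / n) * 1) * Fᵀ := by
    have : diagonal (fun i => l i - (∑ j, l j) / n) = diagonal l - ((∑ j, l j) / n) • 1 := by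
      rw [smul_one_eq_diagonal, diagonal_sub]
    rw [traceless, htr, mul_one, this, Matrix.mul_sub, Matrix.sub_mul, ← e1, Matrix.mul_smul,
      Matrix.mul_one, Matrix.smul_mul, ← e0]
    congr 2
    ring
  rw [htl, e0', trProd_conj_diagonal hF (d := 1) fun _ => one_ne_zero, norm_chart_sq hn e0 hexp]
  simp only [sub_sq, Finset.sum_add_distrib, Finset.sum_sub_distrib, Finset.sum_const,
    Finset.card_univ, Fintype.card_fin, nsmul_eq_mul, ← Finset.sum_mul, ← Finset.mul_sum]
  field_simp
  ring

theorem ang_lt_pi_iff (hn : 1 ≤ n) (a b : Fiber g) :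
    ang a b < Real.pi ↔ ‖chart a b‖ ^ 2 < (4 * Real.pi) ^ 2 / n := by
  have hn' : (0 : ℝ) < n := by exact_mod_cast hn
  rw [← sq_lt_sq₀ (ang_nonneg a b) Real.pi_pos.le, ← ang_sq_eq hn, coneScale_sq,
    lt_div_iff₀ hn', mul_pow, mul_right_comm, div_mul_cancel₀ _ hn'.ne']
  norm_num

end Completion

end MetricFiber


open MetricFiber
theorem mainTheorem8 {n : ℕ} (hn : 1 ≤ n) (g : Matrix (Fin n) (Fin n) ℝ) (hg : g.PosDef) :
    (∀ p q : CompletedFiber g, ∃! γ : C(unitInterval, CompletedFiber g), IsGeodesic γ p q) ∧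
    (∀ (α β : ℕ → CompletedFiber g) (p q : CompletedFiber g)
      (γ : ℕ → C(unitInterval, CompletedFiber g)) (γ' : C(unitInterval, CompletedFiber g)),
      Tendsto α atTop (𝓝 p) → Tendsto β atTop (𝓝 q) →
      (∀ k, IsGeodesic (γ k) (α k) (β k)) → IsGeodesic γ' p q →
      Tendsto γ atTop (𝓝 γ')) ∧
    (∀ (a₀ a₁ : Fiber g) (b : Matrix (Fin n) (Fin n) ℝ)
      (γ : C(unitInterval, CompletedFiber g)),
      b.IsSymm → a₁.mat = a₀.mat * NormedSpace.exp (a₀.mat⁻¹ * b) →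
      IsGeodesic γ (a₀ : CompletedFiber g) (a₁ : CompletedFiber g) →
      (trProd a₀.mat (traceless a₀.mat b) (traceless a₀.mat b) < (4 * Real.pi) ^ 2 / (n : ℝ) →
        ∀ t : unitInterval, ∃ a : Fiber g, γ t = (a : CompletedFiber g)) ∧
      ((4 * Real.pi) ^ 2 / (n : ℝ) ≤ trProd a₀.mat (traceless a₀.mat b) (traceless a₀.mat b) →
        ∀ t : unitInterval, γ t = brokenSegment hg a₀ a₁ t)) := by
  -- A geodesic at time `t` is the barycenter of ratio `t`, so the third claim only has to locate
  -- barycenters on either side of angle `π`.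
  refine ⟨fun p q => existsUnique_isGeodesic fun t ht => exists_isBarycenter hn hg p q ht,
    fun α β p q γ γ' hα hβ hγ hγ' => tendsto_isGeodesic
      (fun t ht => exists_isBarycenter hn hg p q ht) hα hβ hγ hγ',
    fun a₀ a₁ b γ hb hab hγ => ⟨fun h t => ?_, fun h t => ?_⟩⟩
  · rw [trProd_traceless_eq hn hb hab, ← ang_lt_pi_iff hn] at h
    obtain ⟨m, hm⟩ := exists_isBarycenter_of_ang_lt hn hg a₀ a₁ h t.2
    exact ⟨m, hγ.eq_of_isBarycenter t hm⟩
  · rw [trProd_traceless_eq hn hb hab, ← not_lt, ← ang_lt_pi_iff hn, not_lt] at h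
    exact hγ.eq_of_isBarycenter t (isBarycenter_brokenSegment hn hg a₀ a₁ h t.2)
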